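/- Let $\mathbb{S}^2\subset\mathbb{R}^3$ be the unit sphere with its rotation invariant surface measure $\sigma$ (of total mass $4\pi$), let $\eta=(0,0,1)$, and let $\|\cdot\|_2$ be the norm of the complex space $L^2(\mathbb{S}^2,\sigma)$. For $-1\le\delta\le 1$ let $\mathcal{C}_\delta(\eta)=\{y\in\mathbb{S}^2:\langle \eta,y\rangle\ge\delta\}$. Let $P_l$ be the Legendre polynomial of degree $l$, and for $L\ge 1$ let $t_{L,L}$ be the largest zero of $P_L$. Let $Y_l^m$, $|m|\le l$, $l=0,1,2,\dots$, be the orthonormal spherical harmonics, and let $\mathcal{S}_L$ be the space of all $f\in L^2(\mathbb{S}^2)$ such that $\int_{\mathbb{S}^2} f\,\overline{Y_l^m}\,d\sigma=0$ whenever $l>L$ and $|m|\le l$. A function $g$ on $\mathbb{S}^2$ is zonal if $g(x)$ depends only on $\langle x,\eta\rangle$; it is then also regarded as a function on $[-1,1]$ through $g(x)=g(\langle x,\eta\rangle)$. Let $\mathcal{Z}^2_\delta$ be the set of zonal $g\in L^2(\mathbb{S}^2)$ that vanish almost everywhere outside $\mathcal{C}_\delta(\eta)$. For zonal $g\in L^2(\mathbb{S}^2)$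 and $h\in L^2(\mathbb{S}^2)$ put $$(h\ast g)(x)=\int_{\mathbb{S}^2}h(y)\,g(\langle x,y\rangle)\,d\sigma(y),\qquad x\in\mathbb{S}^2,$$ and define $$C_2(L,\delta)=\inf_{g\in\mathcal{Z}^2_\delta\setminus\{0\}}\ \sup_{h\in\mathcal{S}_L\setminus\{0\}}\frac{\|h\|_2^2\,\|g\|_2^2}{\|h\ast g\|_2^2}\in[0,\infty],$$ where the quotient is $\infty$ if $h\ast g=0$. **Theorem.** Let $L\ge 1$ be an integer and $t_{L,L}\le\delta<1$. Then the function $g_\delta=\chi_{\mathcal{C}_\delta(\eta)}\cdot P_L(\langle\cdot,\eta\rangle)$ belongs to $\mathcal{Z}^2_\delta\setminus\{0\}$ and is a minimizer of the extremal problem defining $C_2(L,\delta)$, that is, the infimum is attained at $g=g_\delta$. The minimum is $$C_2(L,\delta)=\left(2\pi\int_\delta^1 P_L(t)^2\,dt\right)^{-1}.$$ -/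

import Mathlib

open MeasureTheory Polynomial

namespace SphereSieve

noncomputable section

/-- Euclidean three-space. -/
abbrev E3 : Type := EuclideanSpace ℝ (Fin 3)

/-- The unit sphere in three-space. -/
abbrev S2 : Type := Metric.sphere (0 : E3) 1

/-- The rotation invariant surface measure on the sphere (total mass `4 * π`). -/
def surfaceMeasure : Measure S2 := (volume : Measure E3).toSphere

/-- The north pole `(0, 0, 1)`. -/
def northPole : S2 := ⟨EuclideanSpace.single 2 1, by simp⟩

/-- The height `⟨x, η⟩` of a point over the equatorial plane, i.e. its `z`-coordinate. -/
def height (x : S2) : ℝ := inner ℝ (x : E3) (northPole : E3)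

/-- The spherical cap with apex `x` and polar angle `arccos δ`. -/
def cap (δ : ℝ) (x : S2) : Set S2 := {y | δ ≤ inner ℝ (x : E3) (y : E3)}

/-- The Legendre polynomial of degree `l` (Rodrigues formula). -/
def legendre (l : ℕ) : ℝ[X] :=
  C ((-1) ^ l / (2 ^ l * (l.factorial : ℝ))) * derivative^[l] ((1 - X ^ 2) ^ l)

/-- The associated Legendre function of degree `l` and order `m`, for `|m| ≤ l`. -/
def assocLegendre (l : ℕ) (m : ℤ) (t : ℝ) : ℝ :=
  (-1) ^ (m + (l : ℤ)).toNat / (2 ^ l * (l.factorial : ℝ)) * (1 - t ^ 2) ^ ((m : ℝ) / 2) *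
    (derivative^[(m + (l : ℤ)).toNat] ((1 - X ^ 2) ^ l : ℝ[X])).eval t

/-- The largest real zero of the Legendre polynomial of degree `L` (meant for `1 ≤ L`). -/
def largestZero (L : ℕ) : ℝ := sSup {t : ℝ | (legendre L).eval t = 0}

/-- The spherical harmonic of degree `l` and order `m`, for `|m| ≤ l`. With
`x = (sin θ cos φ, sin θ sin φ, cos θ)` one has `cos θ = x 2` and `φ = arg (x 0 + i * x 1)` up to
a multiple of `2 * π`. -/
def sphericalHarmonic (l : ℕ) (m : ℤ) (x : S2) : ℂ :=
  (Real.sqrt ((2 * (l : ℝ) + 1) / (4 * Real.pi) *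
      ((((l : ℤ) - m).toNat.factorial : ℝ) / (((l : ℤ) + m).toNat.factorial : ℝ))) : ℂ) *
    (assocLegendre l m ((x : E3) 2) : ℂ) *
    Complex.exp (Complex.I * (m : ℂ) * (Complex.arg ⟨(x : E3) 0, (x : E3) 1⟩ : ℂ))

/-- The spherical harmonics coefficients of `f`. -/
def coeff (f : S2 → ℂ) (l : ℕ) (m : ℤ) : ℂ :=
  ∫ x, f x * (starRingEnd ℂ) (sphericalHarmonic l m x) ∂surfaceMeasure

/-- Band-limited square integrable functions with maximum degree `L`. -/
def bandLimited (L : ℕ) : Set (S2 → ℂ) :=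
  {f | MemLp f 2 surfaceMeasure ∧
    ∀ (l : ℕ) (m : ℤ), L < l → |m| ≤ (l : ℤ) → coeff f l m = 0}

/-- A function on the sphere is zonal if it depends only on the height. -/
def IsZonal (g : S2 → ℂ) : Prop := ∀ x y : S2, height x = height y → g x = g y

/-- A zonal function `g` viewed as a function of the height `t ∈ [-1, 1]`: `profile g t` is the
value of `g` at any point of height `t` (and `0` outside `[-1, 1]`). -/
def profile (g : S2 → ℂ) : ℝ → ℂ := Function.extend height g 0

/-- The profile of a zonal function recovers the function. -/
theorem profile_height {g : S2 → ℂ} (hg : IsZonal g) (x : S2) : profile g (height x) = g x :=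
  Function.FactorsThrough.extend_apply (fun _ _ h => hg _ _ h) 0 x

/-- Convolution of `f` with the zonal function `g`: `∫ f(y) g(⟨x, y⟩) dσ(y)`. -/
def conv (f g : S2 → ℂ) (x : S2) : ℂ :=
  ∫ y, f y * profile g (inner ℝ (x : E3) (y : E3)) ∂surfaceMeasure

/-- The zonal square integrable functions that are supported (up to null sets) in the cap of polar
angle `arccos δ` around the north pole. -/
def zonalL2 (δ : ℝ) : Set (S2 → ℂ) :=
  {g | MemLp g 2 surfaceMeasure ∧ IsZonal g ∧
    ∀ᵐ x ∂surfaceMeasure, x ∉ cap δ northPole → g x = 0}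

/-- The functions that vanish almost everywhere, i.e. the zero vector of `L²`. -/
def nullFunctions : Set (S2 → ℂ) := {f | f =ᵐ[surfaceMeasure] 0}

/-- `sup ‖h‖₂² ‖g‖₂² / ‖h ∗ g‖₂²` over the nonzero band-limited `h`, in `[0, ∞]`; the quotient is
`∞` where `g ≠ 0` and `h ∗ g = 0`. -/
def supQuotient (L : ℕ) (g : S2 → ℂ) : ENNReal :=
  ⨆ h ∈ bandLimited L \ nullFunctions,
    eLpNorm h 2 surfaceMeasure ^ 2 * eLpNorm g 2 surfaceMeasure ^ 2 /
      eLpNorm (conv h g) 2 surfaceMeasure ^ 2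

/-- The optimal constant: the infimum of `supQuotient` over the nonzero `g`. -/
def C2 (L : ℕ) (δ : ℝ) : ENNReal :=
  ⨅ g ∈ zonalL2 δ \ nullFunctions, supQuotient L g

/-- The Legendre polynomial of degree `L` in the height, cut off to the cap around the north
pole. -/
def gDelta (L : ℕ) (δ : ℝ) : S2 → ℂ :=
  (cap δ northPole).indicator fun x => (((legendre L).eval (height x) : ℝ) : ℂ)

end

end SphereSieve

open SphereSieve

namespace SphereSieve

/-! By the Funk–Hecke formula (`conv_harmonic`), convolution with a zonal `g` multiplies every
spherical harmonic of degree `l` by the scalar `multiplier g l`, the integral of `P_l(z) g`. A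
band-limited `h` is a sum of orthogonal components `h_l` with `l ≤ L`, so `‖h ∗ g‖²` is the sum of
`|multiplier g l|² ‖h_l‖²`, and only the multipliers of degree at most `L` matter. Write `A` for
`capEnergy L δ`, which is `‖g_δ‖²`.

Lower bound, for every admissible `g`: test with `h = P_L(z)`. Since `g` lives on the cap,
`multiplier g L` is the inner product of `g` with `g_δ`, so Cauchy–Schwarz gives `|multiplier g L|²
≤ A ‖g‖²` and the quotient is at least `1 / A` (`norm_multiplier_sq_le`, `le_supQuotient`).

Upper bound, for `g_δ`: to the right of its largest zero `P_L` is positive and lies below each `P_l`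
with `l ≤ L` (`legendre_le_of_le`). Hence `multiplier (gDelta L δ) l ≥ A` for all these `l`, and the
quotient is at most `A / A² = 1 / A` (`capEnergy_le_norm_multiplier`, `supQuotient_gDelta_le`).

The analytic input is Archimedes' hat-box theorem, which turns zonal integrals into integrals over
`[-1, 1]`, and the completeness of the explicitly given harmonics. Harmonics are treated without the
Laplacian, as polynomial functions orthogonal to those of smaller degree. -/

/-! ### Recurrences for the Legendre polynomials -/

theorem iterate_derivative_X_mul (n : ℕ) (p : ℝ[X]) :
    derivative^[n] (X * p) = X * derivative^[n] p + (n : ℝ[X]) * derivative^[n - 1] p := by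
  cases n with
  | zero => simp
  | succ n =>
    induction n with
    | zero => simp [add_comm]
    | succ n ih =>
      rw [Function.iterate_succ_apply', ih]
      simp only [Nat.add_sub_cancel, derivative_add, derivative_mul, derivative_X,
        derivative_natCast, ← Function.iterate_succ_apply' (⇑derivative)]
      push_cast
      ring

/-- The normalized power `(X ^ 2 - 1) ^ l / (2 ^ l * l!)`, whose `l`-th derivative is the Legendre
polynomial. -/
noncomputable def rodrigues (l : ℕ) : ℝ[X] :=
  C (1 / (2 ^ l * (l.factorial : ℝ))) * (X ^ 2 - 1) ^ l

theorem legendre_eq (l : ℕ) : legendre l = derivative^[l] (rodrigues l) := by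
  rw [rodrigues, iterate_derivative_C_mul, legendre,
    show ((1 : ℝ[X]) - X ^ 2) ^ l = C ((-1) ^ l) * (X ^ 2 - 1) ^ l by
      rw [C_pow, ← mul_pow]; congr 1; simp,
    iterate_derivative_C_mul, ← mul_assoc, ← C_mul]
  congr 2
  rw [div_mul_eq_mul_div, ← mul_pow]
  norm_num

theorem derivative_rodrigues_succ (l : ℕ) : derivative (rodrigues (l + 1)) = X * rodrigues l := by
  have h : ((1 / (2 ^ l * (l.factorial : ℝ)) : ℝ)) =
      1 / (2 ^ (l + 1) * ((l + 1).factorial : ℝ)) * ((l + 1 : ℕ) * 2) := by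
    rw [Nat.factorial_succ]
    push_cast
    have : ((l : ℝ) + 1) ≠ 0 := by positivity
    field_simp
    ring
  rw [rodrigues, rodrigues, h, derivative_C_mul, derivative_pow_succ]
  simp only [C_mul, derivative_sub, derivative_X_pow, derivative_one]
  push_cast
  simp only [map_add, map_natCast, map_one, map_ofNat]
  ring

/-- The first-order differential equation of `(X ^ 2 - 1) ^ l`. It is written with nested products
by `X` so that `iterate_derivative_X_mul` can differentiate it `l` times. -/
theorem sq_sub_one_mul_derivative_rodrigues (l : ℕ) :
    X * (X * derivative (rodrigues l)) - derivative (rodrigues l) =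
      C (2 * (l : ℝ)) * (X * rodrigues l) := by
  cases l with
  | zero => simp [rodrigues]
  | succ l =>
    rw [derivative_rodrigues_succ]
    have h : (X ^ 2 - 1) * rodrigues l = C (2 * ((l + 1 : ℕ) : ℝ)) * rodrigues (l + 1) := by
      have : ((1 / (2 ^ l * (l.factorial : ℝ)) : ℝ)) =
          (2 * ((l + 1 : ℕ) : ℝ)) * (1 / (2 ^ (l + 1) * ((l + 1).factorial : ℝ))) := by
        rw [Nat.factorial_succ]
        push_cast
        have : ((l : ℝ) + 1) ≠ 0 := by positivity
        field_simp
        ring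
      rw [rodrigues, rodrigues, this, C_mul (a := 2 * ((l + 1 : ℕ) : ℝ)), pow_succ]
      ring
    linear_combination X * h

/-- Leibniz applied to `X * rodrigues l`; the truncated `l - 1` at `l = 0` is harmless because its
coefficient is zero. -/
theorem legendre_succ_eq (l : ℕ) :
    legendre (l + 1) = X * legendre l + (l : ℝ[X]) * derivative^[l - 1] (rodrigues l) := by
  rw [legendre_eq, legendre_eq, Function.iterate_succ_apply, derivative_rodrigues_succ,
    iterate_derivative_X_mul]

theorem derivative_legendre_succ (l : ℕ) :
    derivative (legendre (l + 1)) = X * derivative (legendre l) + (l + 1 : ℝ[X]) * legendre l := by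
  rw [legendre_succ_eq]
  cases l with
  | zero => simp [add_comm]
  | succ l =>
    rw [Nat.add_sub_cancel, derivative_add, derivative_mul, derivative_mul,
      derivative_natCast, ← Function.iterate_succ_apply' (⇑derivative), ← legendre_eq]
    simp only [derivative_X]
    push_cast
    ring

theorem legendre_differential_recurrence (l : ℕ) :
    (l + 1 : ℝ[X]) * legendre (l + 1) =
      (l + 1 : ℝ[X]) * (X * legendre l) + (X ^ 2 - 1) * derivative (legendre l) := by
  have h := congrArg (derivative^[l]) (sq_sub_one_mul_derivative_rodrigues l)
  rw [iterate_derivative_sub, iterate_derivative_C_mul] at h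
  simp only [iterate_derivative_X_mul] at h
  cases l with
  | zero =>
    simp [legendre_succ_eq, legendre_eq, rodrigues]
  | succ l =>
    rw [legendre_succ_eq]
    simp only [Nat.add_sub_cancel] at h ⊢
    have e1 : derivative^[l + 1] (derivative (rodrigues (l + 1))) =
        derivative (legendre (l + 1)) := by
      rw [legendre_eq, ← Function.iterate_succ_apply, ← Function.iterate_succ_apply' (⇑derivative)]
    have e2 : derivative^[l] (derivative (rodrigues (l + 1))) = legendre (l + 1) := by
      rw [legendre_eq, ← Function.iterate_succ_apply]
    rw [← legendre_eq, e1, e2] at h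
    cases l with
    | zero =>
      simp only [C_mul, map_natCast, map_ofNat] at h
      simp at h ⊢
      linear_combination -h
    | succ l =>
      have e3 : derivative^[l + 1 - 1] (derivative (rodrigues (l + 1 + 1))) =
          derivative^[l + 1] (rodrigues (l + 1 + 1)) := by
        rw [Nat.add_sub_cancel, ← Function.iterate_succ_apply]
      rw [e3] at h
      simp only [C_mul, map_natCast, map_ofNat] at h
      push_cast at h ⊢
      linear_combination -h

/-! ### Comparison of Legendre polynomials to the right of the largest zero -/

theorem legendre_eval_one (l : ℕ) : (legendre l).eval 1 = 1 := by
  induction l with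
  | zero => simp [legendre]
  | succ l ih =>
    have h := congrArg (eval 1) (legendre_differential_recurrence l)
    simp [ih] at h
    have : ((l : ℝ) + 1) ≠ 0 := by positivity
    exact (mul_eq_left₀ this).1 h

/-- The two recurrences turn `l + 1` times the Wronskian into `((l + 1) P_l)² + (1 - t²) P_l'²`. -/
theorem legendre_wronskian_nonneg (l : ℕ) {t : ℝ} (ht : t ^ 2 ≤ 1) :
    0 ≤ (derivative (legendre (l + 1))).eval t * (legendre l).eval t -
      (legendre (l + 1)).eval t * (derivative (legendre l)).eval t := by
  have hA := congrArg (eval t) (derivative_legendre_succ l)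
  have hB := congrArg (eval t) (legendre_differential_recurrence l)
  simp at hA hB
  set p := (legendre l).eval t
  set p' := (derivative (legendre l)).eval t
  set q := (legendre (l + 1)).eval t
  set q' := (derivative (legendre (l + 1))).eval t
  have hl : (0 : ℝ) < l + 1 := by positivity
  refine nonneg_of_mul_nonneg_right (a := (l : ℝ) + 1) ?_ hl
  have : ((l : ℝ) + 1) * (q' * p - q * p') = (((l : ℝ) + 1) * p) ^ 2 + (1 - t ^ 2) * p' ^ 2 := by
    linear_combination ((l : ℝ) + 1) * p * hA - p' * hB
  rw [this]
  have := sub_nonneg.2 ht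
  positivity

/-- By the Wronskian inequality `P_l / P_{l+1}` is antitone where the denominator is positive, and
it equals 1 at the right endpoint. -/
theorem legendre_succ_le {l : ℕ} {a : ℝ} (ha : -1 ≤ a)
    (hpos : ∀ t, a < t → t ≤ 1 → 0 < (legendre (l + 1)).eval t) {t : ℝ} (hat : a < t) (ht : t ≤ 1) :
    (legendre (l + 1)).eval t ≤ (legendre l).eval t := by
  have hmem : ∀ s ∈ Set.Icc t 1, 0 < (legendre (l + 1)).eval s := fun s hs =>
    hpos s (hat.trans_le hs.1) hs.2
  have hanti : AntitoneOn (fun s => (legendre l).eval s / (legendre (l + 1)).eval s)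
      (Set.Icc t 1) := by
    refine antitoneOn_of_deriv_nonpos (convex_Icc t 1) ?_ ?_ ?_
    · exact (Polynomial.continuousOn _).div (Polynomial.continuousOn _)
        fun s hs => (hmem s hs).ne'
    · intro s hs
      exact (((legendre l).hasDerivAt s).fun_div ((legendre (l + 1)).hasDerivAt s)
        (hmem s (interior_subset hs)).ne').differentiableAt.differentiableWithinAt
    · intro s hs
      have hs' := interior_subset hs
      have := (((legendre l).hasDerivAt s).fun_div ((legendre (l + 1)).hasDerivAt s)
        (hmem s hs').ne').deriv
      rw [this]
      have hw := legendre_wronskian_nonneg l (t := s) (by nlinarith [hs'.1, hs'.2])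
      refine div_nonpos_of_nonpos_of_nonneg ?_ (sq_nonneg _)
      linarith
  have h := hanti (Set.left_mem_Icc.2 ht) (Set.right_mem_Icc.2 ht) ht
  simp only [legendre_eval_one, div_one] at h
  rwa [le_div_iff₀ (hmem t (Set.left_mem_Icc.2 ht)), one_mul] at h

/-- Each comparison also hands positivity on `(a, 1]` down to the next lower degree, so the steps
can be chained. -/
theorem legendre_le_of_le {L : ℕ} {a : ℝ} (ha : -1 ≤ a)
    (hpos : ∀ t, a < t → t ≤ 1 → 0 < (legendre L).eval t) {l : ℕ} (hl : l ≤ L)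
    {t : ℝ} (hat : a < t) (ht : t ≤ 1) :
    (legendre L).eval t ≤ (legendre l).eval t := by
  induction L, hl using Nat.le_induction generalizing t with
  | base => exact le_rfl
  | succ n hn ih =>
    have hstep : ∀ s, a < s → s ≤ 1 → (legendre (n + 1)).eval s ≤ (legendre n).eval s :=
      fun s h1 h2 => legendre_succ_le ha hpos h1 h2
    exact (hstep t hat ht).trans
      (ih (fun s h1 h2 => (hpos s h1 h2).trans_le (hstep s h1 h2)) hat ht)

theorem iterate_derivative_comp_neg (n : ℕ) (p : ℝ[X]) :
    derivative^[n] (p.comp (-X)) = (-1) ^ n * (derivative^[n] p).comp (-X) := by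
  induction n generalizing p with
  | zero => simp
  | succ n ih =>
    rw [Function.iterate_succ_apply, derivative_comp, derivative_neg, derivative_X, neg_one_mul,
      iterate_derivative_neg, ih, Function.iterate_succ_apply, pow_succ]
    ring

theorem legendre_comp_neg (l : ℕ) : (legendre l).comp (-X) = (-1) ^ l * legendre l := by
  have h := iterate_derivative_comp_neg l (((1 : ℝ[X]) - X ^ 2) ^ l)
  have e : (((1 : ℝ[X]) - X ^ 2) ^ l).comp (-X) = (1 - X ^ 2) ^ l := by simp
  rw [e] at h
  rw [legendre, mul_comp, C_comp, mul_left_comm]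
  nth_rw 2 [h]
  rw [← mul_assoc ((-1 : ℝ[X]) ^ l), ← mul_pow]
  simp

theorem legendre_ne_zero (l : ℕ) : legendre l ≠ 0 := fun h => by
  simpa [h] using legendre_eval_one l

theorem bddAbove_legendre_zeros (L : ℕ) : BddAbove {t : ℝ | (legendre L).eval t = 0} := by
  refine ((legendre L).roots.toFinset.finite_toSet.subset fun t ht => ?_).bddAbove
  simpa [legendre_ne_zero] using ht

/-- Zeros come in pairs `±t` by parity; without zeros, `sSup ∅ = 0`. This serves to ensure `-1 ≤ δ`.
-/
theorem largestZero_nonneg (L : ℕ) : 0 ≤ largestZero L := by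
  rcases Set.eq_empty_or_nonempty {t : ℝ | (legendre L).eval t = 0} with h | ⟨t, ht⟩
  · rw [largestZero, h, Real.sSup_empty]
  · have h1 := le_csSup (bddAbove_legendre_zeros L) ht
    have ht' : (legendre L).eval (-t) = 0 := by
      have := congrArg (eval t) (legendre_comp_neg L)
      rw [eval_comp, eval_mul, ht.out] at this
      simpa using this
    have h2 := le_csSup (bddAbove_legendre_zeros L) ht'
    rw [largestZero]
    linarith

theorem legendre_pos_of_largestZero_lt {L : ℕ} {t : ℝ} (ht : largestZero L < t) (ht1 : t ≤ 1) :
    0 < (legendre L).eval t := by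
  by_contra! h
  obtain ⟨s, hs, hs0⟩ := intermediate_value_Icc ht1 ((legendre L).continuousOn)
    ⟨h, (legendre_eval_one L).symm ▸ zero_le_one⟩
  exact (ht.trans_le (hs.1.trans (le_csSup (bddAbove_legendre_zeros L) hs0))).false

/-! ### Integration by parts -/

/-- Repeated integration by parts on `[-1, 1]` with vanishing boundary terms. -/
theorem integral_iterate_derivative_mul (n : ℕ) (p r : ℝ[X])
    (h : ∀ i < n, (1 - X ^ 2 : ℝ[X]) ∣ derivative^[n - 1 - i] p * derivative^[i] r) :
    ∫ t in (-1 : ℝ)..1, (derivative^[n] p).eval t * r.eval t =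
      (-1) ^ n * ∫ t in (-1 : ℝ)..1, p.eval t * (derivative^[n] r).eval t := by
  induction n generalizing r with
  | zero => simp
  | succ n ih =>
    have h0 := h 0 n.succ_pos
    simp only [Nat.add_sub_cancel, Nat.sub_zero, Function.iterate_zero, id] at h0
    have hb : ∀ t : ℝ, t ^ 2 = 1 → (derivative^[n] p).eval t * r.eval t = 0 := by
      intro t ht
      obtain ⟨c, hc⟩ := h0
      rw [← eval_mul, hc]
      simp [ht]
    have hparts := intervalIntegral.integral_mul_deriv_eq_deriv_mul (a := -1) (b := 1)
      (u := fun t => r.eval t) (v := fun t => (derivative^[n] p).eval t)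
      (fun t _ => r.hasDerivAt t) (fun t _ => (derivative^[n] p).hasDerivAt t)
      ((derivative r).continuous.intervalIntegrable _ _)
      ((derivative (derivative^[n] p)).continuous.intervalIntegrable _ _)
    have ih' := ih (derivative r) fun i hi => by
      have := h (i + 1) (by omega)
      rwa [Function.iterate_succ_apply, show n + 1 - 1 - (i + 1) = n - 1 - i by omega] at this
    simp only [Function.iterate_succ_apply' (⇑derivative) n p, Function.iterate_succ_apply _ n r]
    rw [pow_succ, mul_right_comm, ← ih']
    simp only [mul_comm (eval _ (derivative (derivative^[n] p))),
      mul_comm (eval _ (derivative^[n] p))]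
    rw [hparts, mul_comm (r.eval 1), mul_comm (r.eval (-1)), hb 1 (by norm_num),
      hb (-1) (by norm_num)]
    ring

/-! ### The height function and the invariance of the surface measure -/

theorem height_eq (x : S2) : height x = (x : E3) 2 := by
  simp [height, northPole, EuclideanSpace.inner_single_right]

theorem continuous_height : Continuous height := by
  unfold height; fun_prop

theorem height_mem_Icc (x : S2) : height x ∈ Set.Icc (-1 : ℝ) 1 := by
  have h := abs_real_inner_le_norm (x : E3) (northPole : E3)
  rw [norm_eq_of_mem_sphere x, norm_eq_of_mem_sphere northPole, one_mul] at h
  exact abs_le.1 h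

theorem northPole_height : height northPole = 1 := by
  simp [height_eq, northPole]

instance : IsFiniteMeasure surfaceMeasure := by unfold surfaceMeasure; infer_instance

instance : surfaceMeasure.IsOpenPosMeasure := by unfold surfaceMeasure; infer_instance

/-- A linear isometry of space, restricted to the unit sphere. -/
noncomputable def sphereMap (R : E3 ≃ₗᵢ[ℝ] E3) : C(S2, S2) where
  toFun x := ⟨R x, by simp⟩
  continuous_toFun := by fun_prop

@[simp] theorem coe_sphereMap (R : E3 ≃ₗᵢ[ℝ] E3) (x : S2) : (sphereMap R x : E3) = R x := rfl

/-- A linear isometry of space, as a homeomorphism of the unit sphere. -/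
noncomputable def sphereHomeomorph (R : E3 ≃ₗᵢ[ℝ] E3) : S2 ≃ₜ S2 where
  toFun := sphereMap R
  invFun := sphereMap R.symm
  left_inv x := Subtype.ext (by simp)
  right_inv x := Subtype.ext (by simp)
  continuous_toFun := (sphereMap R).continuous
  continuous_invFun := (sphereMap R.symm).continuous

open scoped Pointwise in
-- The measure of `s` is a multiple of the volume of the cone `Ioo 0 1 • s`; a linear isometry maps
-- cones to cones and preserves volume.
theorem measurePreserving_sphereMap (R : E3 ≃ₗᵢ[ℝ] E3) :
    MeasurePreserving (sphereMap R) surfaceMeasure surfaceMeasure := by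
  refine ⟨(sphereMap R).continuous.measurable, ?_⟩
  ext s hs
  have hm := (sphereMap R).continuous.measurable hs
  rw [Measure.map_apply (sphereMap R).continuous.measurable hs, surfaceMeasure,
    Measure.toSphere_apply' _ hm, Measure.toSphere_apply' _ hs]
  congr 1
  rw [← R.measurePreserving.measure_preimage_emb R.toHomeomorph.measurableEmbedding
    (Set.Ioo (0 : ℝ) 1 • (Subtype.val '' s))]
  congr 1
  ext x
  simp only [Set.mem_smul, Set.mem_image, Set.mem_preimage]
  constructor
  · rintro ⟨r, hr, _, ⟨y, hy, rfl⟩, rfl⟩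
    exact ⟨r, hr, _, ⟨_, hy, rfl⟩, by simp⟩
  · rintro ⟨r, hr, _, ⟨y, hy, rfl⟩, h⟩
    refine ⟨r, hr, _, ⟨sphereMap R.symm y, ?_, rfl⟩, ?_⟩
    · convert hy
      exact Subtype.ext (by simp)
    · apply R.injective
      simpa using h

theorem integral_comp_sphereMap (R : E3 ≃ₗᵢ[ℝ] E3) (f : S2 → ℂ) :
    ∫ x, f (sphereMap R x) ∂surfaceMeasure = ∫ x, f x ∂surfaceMeasure :=
  (measurePreserving_sphereMap R).integral_comp (sphereHomeomorph R).measurableEmbedding f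

/-! ### Gaussian moments and the hat-box theorem -/

theorem integral_Ioi_pow_mul_exp (n : ℕ) :
    ∫ t in Set.Ioi (0 : ℝ), t ^ n * Real.exp (-t ^ 2) = Real.Gamma (((n : ℝ) + 1) / 2) / 2 := by
  have := integral_rpow_mul_exp_neg_rpow (p := 2) (q := n) two_pos
    (by have : (0 : ℝ) ≤ n := n.cast_nonneg
        linarith)
  simp only [Real.rpow_natCast, Real.rpow_ofNat] at this
  rw [this]; ring

theorem integrable_pow_mul_exp (n : ℕ) :
    Integrable (fun t : ℝ => t ^ n * Real.exp (-t ^ 2)) := by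
  have := integrable_rpow_mul_exp_neg_mul_sq (b := 1) one_pos (s := n)
    (by have : (0 : ℝ) ≤ n := n.cast_nonneg
        linarith)
  simpa [Real.rpow_natCast] using this

theorem integral_pow_mul_exp (n : ℕ) :
    ∫ t : ℝ, t ^ n * Real.exp (-t ^ 2) =
      (1 + (-1) ^ n) * (Real.Gamma (((n : ℝ) + 1) / 2) / 2) := by
  rw [← intervalIntegral.integral_Iic_add_Ioi (b := 0) (integrable_pow_mul_exp n).integrableOn
    (integrable_pow_mul_exp n).integrableOn]
  have : ∫ t in Set.Iic (0 : ℝ), t ^ n * Real.exp (-t ^ 2) =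
      (-1) ^ n * ∫ t in Set.Ioi (0 : ℝ), t ^ n * Real.exp (-t ^ 2) := by
    rw [← integral_const_mul, ← neg_zero, ← integral_comp_neg_Iic, neg_zero]
    congr 1
    ext t
    rw [neg_sq, ← mul_assoc, ← mul_pow]
    simp
  rw [this, integral_Ioi_pow_mul_exp]
  ring

theorem integral_euclidean_pow_mul_exp (n : ℕ) :
    ∫ x : E3, x 2 ^ n * Real.exp (-‖x‖ ^ 2) =
      Real.pi * ((1 + (-1) ^ n) * (Real.Gamma (((n : ℝ) + 1) / 2) / 2)) := by
  rw [← (PiLp.volume_preserving_toLp (Fin 3)).integral_comp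
    (MeasurableEquiv.toLp 2 (Fin 3 → ℝ)).measurableEmbedding]
  have h := integral_fintype_prod_volume_eq_prod (ι := Fin 3) (E := fun _ => ℝ) (𝕜 := ℝ)
    (fun i t => t ^ (if i = 2 then n else 0) * Real.exp (-t ^ 2))
  simp only [Fin.prod_univ_three, integral_pow_mul_exp] at h
  have e0 : ((0 : Fin 3) = 2) = False := by simp
  have e1 : ((1 : Fin 3) = 2) = False := by simp
  simp only [e0, e1, if_false, if_true, pow_zero, one_mul, Nat.cast_zero, zero_add,
    Real.Gamma_one_half_eq] at h
  have hpi : (1 + 1 : ℝ) * (√Real.pi / 2) * ((1 + 1) * (√Real.pi / 2)) = Real.pi := by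
    have := Real.mul_self_sqrt Real.pi_pos.le
    linear_combination this
  rw [hpi] at h
  rw [← h]
  congr 1
  ext x
  rw [EuclideanSpace.norm_sq_eq, Fin.sum_univ_three]
  simp only [Real.norm_eq_abs, sq_abs, neg_add, Real.exp_add]
  ring

/-- Polar coordinates: `x 2` is radius times height, and the volume element contributes the extra `r
^ 2`. -/
theorem integral_height_pow_mul (n : ℕ) :
    ∫ x : E3, x 2 ^ n * Real.exp (-‖x‖ ^ 2) =
      (∫ x, height x ^ n ∂surfaceMeasure) *
        ∫ t in Set.Ioi (0 : ℝ), t ^ (n + 2) * Real.exp (-t ^ 2) := by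
  have hd : Module.finrank ℝ E3 - 1 = 2 := by simp
  have hmp := (volume : Measure E3).measurePreserving_homeomorphUnitSphereProd
  rw [hd] at hmp
  calc ∫ x : E3, x 2 ^ n * Real.exp (-‖x‖ ^ 2)
      = ∫ x : ({(0)}ᶜ : Set E3), (x : E3) 2 ^ n * Real.exp (-‖(x : E3)‖ ^ 2)
          ∂((volume : Measure E3).comap (↑)) := by
        rw [integral_subtype_comap (measurableSet_singleton _).compl
          (fun x : E3 => x 2 ^ n * Real.exp (-‖x‖ ^ 2)), restrict_compl_singleton]
    _ = ∫ x : S2 × Set.Ioi (0 : ℝ), height x.1 ^ n * ((x.2 : ℝ) ^ n * Real.exp (-(x.2 : ℝ) ^ 2))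
          ∂(surfaceMeasure.prod (.volumeIoiPow 2)) := by
        rw [surfaceMeasure, ← hmp.integral_comp (Homeomorph.measurableEmbedding _)]
        congr 1
        ext x
        have hx : ‖(x : E3)‖ ≠ 0 := norm_ne_zero_iff.2 x.2
        simp only [height_eq, homeomorphUnitSphereProd_apply_fst_coe,
          homeomorphUnitSphereProd_apply_snd_coe, PiLp.smul_apply, smul_eq_mul]
        rw [← mul_assoc, ← mul_pow]
        congr 2
        field_simp
    _ = (∫ x, height x ^ n ∂surfaceMeasure) * ∫ t : Set.Ioi (0 : ℝ),
          ((t : ℝ) ^ n * Real.exp (-(t : ℝ) ^ 2)) ∂(.volumeIoiPow 2) :=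
        integral_prod_mul (fun x => height x ^ n)
          (fun t : Set.Ioi (0 : ℝ) => (t : ℝ) ^ n * Real.exp (-(t : ℝ) ^ 2))
    _ = _ := by
        congr 1
        simp only [Measure.volumeIoiPow, ENNReal.ofReal]
        rw [integral_withDensity_eq_integral_smul,
          integral_subtype_comap measurableSet_Ioi
            (fun a : ℝ => Real.toNNReal (a ^ 2) • (a ^ n * Real.exp (-a ^ 2))),
          setIntegral_congr_fun measurableSet_Ioi fun x hx ↦ ?_]
        · simp only [NNReal.smul_def, Real.coe_toNNReal _ (sq_nonneg x), smul_eq_mul]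
          ring
        · exact (measurable_subtype_coe.pow_const _).real_toNNReal

/-- The Gaussian integral is computed in Cartesian and in polar coordinates; the functional equation
of `Gamma` cancels the common factor. -/
theorem integral_height_pow (n : ℕ) :
    ∫ x, height x ^ n ∂surfaceMeasure = 2 * Real.pi * ∫ t in (-1 : ℝ)..1, t ^ n := by
  have h := integral_height_pow_mul n
  rw [integral_euclidean_pow_mul_exp, integral_Ioi_pow_mul_exp] at h
  have hpos : (0 : ℝ) < ((n : ℝ) + 1) / 2 := by positivity
  have hG := Real.Gamma_pos_of_pos hpos
  have e : (((n + 2 : ℕ) : ℝ) + 1) / 2 = ((n : ℝ) + 1) / 2 + 1 := by push_cast; ring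
  rw [e, Real.Gamma_add_one hpos.ne'] at h
  rw [integral_pow]
  have hn : (n : ℝ) + 1 ≠ 0 := by positivity
  have : (Real.Gamma (((n : ℝ) + 1) / 2)) ≠ 0 := hG.ne'
  set G := Real.Gamma (((n : ℝ) + 1) / 2)
  set M := ∫ x, height x ^ n ∂surfaceMeasure
  have h' : G * (Real.pi * (1 + (-1) ^ n)) = G * (M * (((n : ℝ) + 1) / 2)) := by
    linear_combination 2 * h
  have h'' := mul_left_cancel₀ this h'
  rw [mul_div_assoc', eq_div_iff hn]
  simp only [one_pow, pow_succ]
  linear_combination -2 * h''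

theorem integral_height_eval (p : ℝ[X]) :
    ∫ x, p.eval (height x) ∂surfaceMeasure = 2 * Real.pi * ∫ t in (-1 : ℝ)..1, p.eval t := by
  have hint : ∀ q : ℝ[X], Integrable (fun x => q.eval (height x)) surfaceMeasure := fun q =>
    (q.continuous.comp continuous_height).integrable_of_hasCompactSupport
      (HasCompactSupport.of_compactSpace _)
  induction p using Polynomial.induction_on' with
  | add p q hp hq =>
    simp only [eval_add]
    rw [integral_add (hint p) (hint q), hp, hq, intervalIntegral.integral_add
      (p.continuous.intervalIntegrable _ _) (q.continuous.intervalIntegrable _ _), mul_add]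
  | monomial n a =>
    simp only [eval_monomial]
    rw [integral_const_mul, integral_height_pow, intervalIntegral.integral_const_mul]
    ring

/-- Archimedes' hat-box theorem: the height of a random point on the sphere is uniformly
distributed. -/
theorem map_height_surfaceMeasure :
    surfaceMeasure.map height =
      ENNReal.ofReal (2 * Real.pi) • volume.restrict (Set.Icc (-1 : ℝ) 1) := by
  have hpi : 0 ≤ 2 * Real.pi := by positivity
  have hle : (-1 : ℝ) ≤ 1 := by norm_num
  have : IsFiniteMeasure (ENNReal.ofReal (2 * Real.pi) • volume.restrict (Set.Icc (-1 : ℝ) 1)) :=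
    Measure.smul_finite _ ENNReal.ofReal_ne_top
  refine ext_of_forall_integral_eq_of_IsFiniteMeasure fun f => ?_
  rw [integral_map continuous_height.aemeasurable f.continuous.aestronglyMeasurable,
    integral_smul_measure, ENNReal.toReal_ofReal hpi, integral_Icc_eq_integral_Ioc,
    ← intervalIntegral.integral_of_le hle, smul_eq_mul]
  have hfi : Integrable (fun x => f (height x)) surfaceMeasure :=
    (f.continuous.comp continuous_height).integrable_of_hasCompactSupport
      (HasCompactSupport.of_compactSpace _)
  -- Weierstrass approximation: for a polynomial uniformly `ε`-close to `f` both sides agree, and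
  -- each side moves by at most `ε` times the mass.
  have key : ∀ ε > 0, |(∫ x, f (height x) ∂surfaceMeasure) -
      2 * Real.pi * ∫ t in (-1 : ℝ)..1, f t| ≤
        ε * (surfaceMeasure.real Set.univ + 2 * Real.pi * 2) := by
    intro ε hε
    obtain ⟨p, hp⟩ := exists_polynomial_near_of_continuousOn (-1) 1 f f.continuous.continuousOn ε hε
    have hpi' : Integrable (fun x => p.eval (height x)) surfaceMeasure :=
      (p.continuous.comp continuous_height).integrable_of_hasCompactSupport
        (HasCompactSupport.of_compactSpace _)
    have h1 : |∫ x, (p.eval (height x) - f (height x)) ∂surfaceMeasure| ≤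
        ε * surfaceMeasure.real Set.univ := by
      have := norm_integral_le_of_norm_le_const (μ := surfaceMeasure)
        (f := fun x => p.eval (height x) - f (height x)) (C := ε)
        (Filter.Eventually.of_forall fun x => (hp _ (height_mem_Icc x)).le)
      simpa using this
    have h2 : |∫ t in (-1 : ℝ)..1, (p.eval t - f t)| ≤ ε * 2 := by
      have := intervalIntegral.norm_integral_le_of_norm_le_const (a := -1) (b := 1)
        (f := fun t => p.eval t - f t) (C := ε) (fun t ht => by
          rw [Set.uIoc_of_le hle] at ht
          exact (hp _ ⟨ht.1.le, ht.2⟩).le)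
      norm_num at this ⊢
      exact this
    rw [integral_sub hpi' hfi] at h1
    rw [intervalIntegral.integral_sub (p.continuous.intervalIntegrable _ _)
      (f.continuous.intervalIntegrable _ _)] at h2
    have h3 := integral_height_eval p
    have e : (∫ x, f (height x) ∂surfaceMeasure) - 2 * Real.pi * ∫ t in (-1 : ℝ)..1, f t =
        2 * Real.pi * ((∫ t in (-1 : ℝ)..1, p.eval t) - ∫ t in (-1 : ℝ)..1, f t) -
        ((∫ x, p.eval (height x) ∂surfaceMeasure) - ∫ x, f (height x) ∂surfaceMeasure) := by
      rw [h3]; ring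
    rw [e]
    refine (abs_sub _ _).trans ?_
    rw [abs_mul, abs_of_nonneg hpi]
    have := mul_le_mul_of_nonneg_left h2 hpi
    linarith
  by_contra hne
  have hpos := abs_pos.2 (sub_ne_zero.2 hne)
  set K := surfaceMeasure.real Set.univ + 2 * Real.pi * 2
  have hK : 0 < K := by
    have : 0 ≤ surfaceMeasure.real Set.univ := measureReal_nonneg
    have := Real.pi_pos
    positivity
  have := key (|(∫ x, f (height x) ∂surfaceMeasure) - 2 * Real.pi * ∫ t in (-1 : ℝ)..1, f t| /
    (2 * K)) (by positivity)
  have e : ∀ a : ℝ, a / (2 * K) * K = a / 2 := fun a => by field_simp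
  rw [e] at this
  linarith

/-! ### Polynomial functions on the sphere -/

/-- The linear functional `⟨w, ·⟩` on the sphere. -/
noncomputable def coordFn (w : E3) : C(S2, ℂ) where
  toFun y := ((inner ℝ w (y : E3) : ℝ) : ℂ)
  continuous_toFun := by fun_prop

/-- The functions on the sphere that are given by polynomials of degree at most one. -/
noncomputable def affineSpace : Submodule ℂ C(S2, ℂ) :=
  Submodule.span ℂ (insert 1 (Set.range coordFn))

/-- The functions on the sphere that are given by polynomials of degree at most `N`. -/
noncomputable def polySpace (N : ℕ) : Submodule ℂ C(S2, ℂ) := affineSpace ^ N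

/-- The function `x + i y` on the sphere. -/
noncomputable def coordU : C(S2, ℂ) :=
  coordFn (EuclideanSpace.single 0 1) + Complex.I • coordFn (EuclideanSpace.single 1 1)

/-- The function `x - i y` on the sphere. -/
noncomputable def coordV : C(S2, ℂ) :=
  coordFn (EuclideanSpace.single 0 1) - Complex.I • coordFn (EuclideanSpace.single 1 1)

/-- The function `z` on the sphere. -/
noncomputable def coordZ : C(S2, ℂ) := coordFn northPole

theorem coordFn_apply (w : E3) (x : S2) : coordFn w x = ((inner ℝ w (x : E3) : ℝ) : ℂ) := rfl

theorem coordU_apply (x : S2) : coordU x = ⟨(x : E3) 0, (x : E3) 1⟩ := by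
  simp [coordU, coordFn_apply, EuclideanSpace.inner_single_left, Complex.ext_iff]

theorem coordV_apply (x : S2) : coordV x = (starRingEnd ℂ) (coordU x) := by
  simp [coordU, coordV, coordFn_apply, sub_eq_add_neg]

theorem coordZ_apply (x : S2) : coordZ x = (height x : ℂ) := by
  rw [coordZ, coordFn_apply, height, real_inner_comm]

theorem norm_coordU_sq (x : S2) : ‖coordU x‖ ^ 2 = 1 - height x ^ 2 := by
  have h := norm_eq_of_mem_sphere x
  have h2 := EuclideanSpace.norm_sq_eq (x : E3)
  rw [h, Fin.sum_univ_three] at h2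
  simp only [Real.norm_eq_abs, sq_abs] at h2
  rw [coordU_apply, Complex.sq_norm, Complex.normSq_mk, height_eq]
  linarith

theorem coordU_mul_coordV : coordU * coordV = 1 - coordZ ^ 2 := by
  ext x
  simp only [ContinuousMap.mul_apply, ContinuousMap.sub_apply, ContinuousMap.one_apply,
    ContinuousMap.pow_apply, coordV_apply, coordZ_apply, Complex.mul_conj, Complex.normSq_eq_norm_sq,
    norm_coordU_sq]
  push_cast
  rfl

/-- The function `(x ± i y) ^ |m|`, which depends on the longitude `φ` through `exp (i m φ)`. -/
noncomputable def azimuth (m : ℤ) : C(S2, ℂ) :=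
  if 0 ≤ m then coordU ^ m.natAbs else coordV ^ m.natAbs

theorem azimuth_mul_conj (m : ℤ) (x : S2) :
    azimuth m x * (starRingEnd ℂ) (azimuth m x) = (((1 - height x ^ 2) ^ m.natAbs : ℝ) : ℂ) := by
  rw [Complex.mul_conj, Complex.normSq_eq_norm_sq, azimuth]
  congr 1
  split_ifs <;>
  simp only [ContinuousMap.pow_apply, coordV_apply, norm_pow, RCLike.norm_conj] <;>
  rw [← pow_mul, mul_comm, pow_mul, norm_coordU_sq]

theorem coordFn_mem (w : E3) : coordFn w ∈ affineSpace :=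
  Submodule.subset_span (Or.inr ⟨w, rfl⟩)

theorem one_le_affineSpace : 1 ≤ affineSpace := by
  rw [Submodule.one_le]
  exact Submodule.subset_span (Or.inl rfl)

theorem polySpace_zero : polySpace 0 = 1 := Submodule.pow_zero _

theorem polySpace_succ (n : ℕ) : polySpace (n + 1) = polySpace n * affineSpace :=
  Submodule.pow_succ _

theorem polySpace_add (m n : ℕ) : polySpace (m + n) = polySpace m * polySpace n := by
  induction n with
  | zero => rw [polySpace_zero, Submodule.mul_one, add_zero]
  | succ n ih =>
    rw [← add_assoc, polySpace_succ, ih, polySpace_succ]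
    exact mul_assoc (polySpace m) (polySpace n) affineSpace

theorem polySpace_mono {m n : ℕ} (h : m ≤ n) : polySpace m ≤ polySpace n := by
  induction n, h using Nat.le_induction with
  | base => exact le_rfl
  | succ n _ ih =>
    rw [polySpace_succ]
    exact ih.trans fun f hf => mul_one f ▸
      Submodule.mul_mem_mul hf (Submodule.one_le.1 one_le_affineSpace)

theorem mul_mem_polySpace {m n : ℕ} {f g : C(S2, ℂ)} (hf : f ∈ polySpace m)
    (hg : g ∈ polySpace n) : f * g ∈ polySpace (m + n) := by
  rw [polySpace_add]
  exact Submodule.mul_mem_mul hf hg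

theorem pow_mem_polySpace {f : C(S2, ℂ)} (hf : f ∈ affineSpace) (n : ℕ) : f ^ n ∈ polySpace n :=
  Submodule.pow_mem_pow _ hf n

theorem coordU_mem : coordU ∈ affineSpace :=
  add_mem (coordFn_mem _) (Submodule.smul_mem _ _ (coordFn_mem _))

theorem coordV_mem : coordV ∈ affineSpace :=
  sub_mem (coordFn_mem _) (Submodule.smul_mem _ _ (coordFn_mem _))

theorem azimuth_mem (m : ℤ) : azimuth m ∈ polySpace m.natAbs := by
  unfold azimuth
  split_ifs
  exacts [pow_mem_polySpace coordU_mem _, pow_mem_polySpace coordV_mem _]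

theorem coordZ_pow_mem (n : ℕ) : coordZ ^ n ∈ polySpace n := pow_mem_polySpace (coordFn_mem _) n

theorem aeval_coordZ_mem (q : ℝ[X]) {n : ℕ} (hq : q.natDegree ≤ n) :
    aeval coordZ q ∈ polySpace n := by
  rw [aeval_eq_sum_range' (Nat.lt_succ_of_le hq)]
  refine Submodule.sum_mem _ fun i hi => ?_
  rw [show q.coeff i • coordZ ^ i = (q.coeff i : ℂ) • coordZ ^ i by ext x; simp]
  exact Submodule.smul_mem _ _ (polySpace_mono (Finset.mem_range_succ_iff.1 hi) (coordZ_pow_mem i))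

theorem aeval_coordZ_apply (q : ℝ[X]) (x : S2) :
    aeval coordZ q x = ((q.eval (height x) : ℝ) : ℂ) := by
  have h := aeval_algHom_apply (ContinuousMap.evalAlgHom ℝ ℂ x) coordZ q
  simp only [ContinuousMap.evalAlgHom_apply] at h
  rw [← h, coordZ_apply, ← Complex.coe_algebraMap, aeval_algebraMap_apply_eq_algebraMap_eval]

theorem affineSpace_le : affineSpace ≤ Submodule.span ℂ {1, coordU, coordV, coordZ} := by
  rw [affineSpace, Submodule.span_le, Set.insert_subset_iff]
  refine ⟨Submodule.subset_span (by simp), ?_⟩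
  rintro _ ⟨w, rfl⟩
  have e : coordFn w = ((w 0 : ℂ) / 2 - Complex.I * (w 1 : ℂ) / 2) • coordU +
      ((w 0 : ℂ) / 2 + Complex.I * (w 1 : ℂ) / 2) • coordV + (w 2 : ℂ) • coordZ := by
    ext x
    simp only [ContinuousMap.add_apply, ContinuousMap.smul_apply, coordV_apply, coordU_apply,
      coordZ_apply, height_eq, coordFn_apply, PiLp.inner_apply, Fin.sum_univ_three]
    apply Complex.ext <;> simp <;> ring
  rw [SetLike.mem_coe, e]
  refine add_mem (add_mem ?_ ?_) ?_ <;>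
  exact Submodule.smul_mem _ _ (Submodule.subset_span (by simp))

/-- For negative `m` one factor `x - iy` is absorbed, since `(x + iy)(x - iy) = 1 - z²`. -/
theorem azimuth_mul_coordU (m : ℤ) : azimuth m * coordU =
    if 0 ≤ m then azimuth (m + 1) else azimuth (m + 1) * (1 - coordZ ^ 2) := by
  rw [← coordU_mul_coordV]
  unfold azimuth
  split_ifs with h1 h2 h2
  · rw [← pow_succ]; congr 1; omega
  · omega
  · obtain rfl : m = -1 := by omega
    simp [mul_comm]
  · rw [show m.natAbs = (m + 1).natAbs + 1 by omega, pow_succ]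
    ring

theorem azimuth_mul_coordV (m : ℤ) : azimuth m * coordV =
    if m ≤ 0 then azimuth (m - 1) else azimuth (m - 1) * (1 - coordZ ^ 2) := by
  rw [← coordU_mul_coordV]
  unfold azimuth
  split_ifs with h1 h2 h3 h2 h3 <;> try omega
  · obtain rfl : m = 0 := by omega
    simp
  · rw [show m.natAbs = (m - 1).natAbs + 1 by omega, pow_succ]
    ring
  · rw [← pow_succ]; congr 1; omega

/-- The monomials `(x ± i y) ^ |m| z ^ j` of degree at most `N` span the polynomial functions. -/
theorem polySpace_eq_span (N : ℕ) : polySpace N =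
    Submodule.span ℂ {f | ∃ (m : ℤ) (j : ℕ), m.natAbs + j ≤ N ∧ f = azimuth m * coordZ ^ j} := by
  set W : ℕ → Submodule ℂ C(S2, ℂ) := fun N =>
    Submodule.span ℂ {f | ∃ (m : ℤ) (j : ℕ), m.natAbs + j ≤ N ∧ f = azimuth m * coordZ ^ j}
  have hW : ∀ {N : ℕ} (m : ℤ) (j : ℕ), m.natAbs + j ≤ N → azimuth m * coordZ ^ j ∈ W N :=
    fun m j h => Submodule.subset_span ⟨m, j, h, rfl⟩
  have haux : ∀ {N : ℕ} (m : ℤ) (j : ℕ), m.natAbs + 2 + j ≤ N →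
      azimuth m * (1 - coordZ ^ 2) * coordZ ^ j ∈ W N := fun m j h => by
    rw [show azimuth m * (1 - coordZ ^ 2) * coordZ ^ j =
      azimuth m * coordZ ^ j - azimuth m * coordZ ^ (2 + j) by ring]
    exact sub_mem (hW m j (by omega)) (hW m (2 + j) (by omega))
  change polySpace N = W N
  refine le_antisymm ?_ ?_
  · induction N with
    | zero =>
      rw [polySpace_zero, Submodule.one_le]
      have := hW (N := 0) 0 0 (by simp)
      simpa [azimuth] using this
    | succ N ih =>
      rw [polySpace_succ]
      refine (mul_le_mul' ih affineSpace_le).trans ?_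
      rw [Submodule.span_mul_span, Submodule.span_le]
      rintro _ ⟨_, ⟨m, j, hmj, rfl⟩, g, hg, rfl⟩
      simp only [Set.mem_insert_iff, Set.mem_singleton_iff] at hg
      simp only [SetLike.mem_coe]
      rcases hg with rfl | rfl | rfl | rfl
      · rw [mul_one]; exact hW m j (by omega)
      · rw [mul_right_comm, azimuth_mul_coordU]
        split_ifs with h
        · exact hW _ _ (by omega)
        · exact haux _ _ (by omega)
      · rw [mul_right_comm, azimuth_mul_coordV]
        split_ifs with h
        · exact hW _ _ (by omega)
        · exact haux _ _ (by omega)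
      · rw [mul_assoc, ← pow_succ]; exact hW m (j + 1) (by omega)
  · rw [Submodule.span_le]
    rintro _ ⟨m, j, hmj, rfl⟩
    exact polySpace_mono hmj (mul_mem_polySpace (azimuth_mem m) (coordZ_pow_mem j))

/-! ### Action of isometries -/

/-- Composition of functions on the sphere with a linear isometry. -/
noncomputable def rotate (R : E3 ≃ₗᵢ[ℝ] E3) : C(S2, ℂ) →ₐ[ℂ] C(S2, ℂ) :=
  ContinuousMap.compRightAlgHom ℂ ℂ (sphereMap R)

theorem rotate_apply (R : E3 ≃ₗᵢ[ℝ] E3) (f : C(S2, ℂ)) (x : S2) :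
    rotate R f x = f (sphereMap R x) := rfl

theorem rotate_mem_polySpace (R : E3 ≃ₗᵢ[ℝ] E3) {N : ℕ} {f : C(S2, ℂ)} (hf : f ∈ polySpace N) :
    rotate R f ∈ polySpace N := by
  have h : affineSpace.map (rotate R).toLinearMap ≤ affineSpace := by
    rw [affineSpace, Submodule.map_span, Submodule.span_le]
    rintro _ ⟨f, rfl | ⟨w, rfl⟩, rfl⟩
    · have : rotate R 1 = 1 := map_one _
      exact this ▸ Submodule.one_le.1 one_le_affineSpace
    · have : rotate R (coordFn w) = coordFn (R.symm w) := by
        ext x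
        rw [rotate_apply, coordFn_apply, coordFn_apply, coe_sphereMap, R.symm.inner_map_eq_flip]
        simp
      exact this ▸ coordFn_mem _
  have h2 : (polySpace N).map (rotate R).toLinearMap ≤ polySpace N := by
    rw [polySpace, Submodule.map_pow]
    exact pow_le_pow_left' h N
  exact h2 ⟨f, hf, rfl⟩

/-- A reflection suffices, since orientation plays no role. -/
theorem exists_isometry_northPole (x : S2) : ∃ R : E3 ≃ₗᵢ[ℝ] E3, sphereMap R northPole = x := by
  refine ⟨(Submodule.span ℝ {(northPole : E3) - (x : E3)})ᗮ.reflection, Subtype.ext ?_⟩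
  rw [coe_sphereMap]
  exact Submodule.reflection_sub (by rw [norm_eq_of_mem_sphere, norm_eq_of_mem_sphere])

/-- The rotation of space around the vertical axis. -/
noncomputable def zRot (α : ℝ) : E3 ≃ₗᵢ[ℝ] E3 :=
  LinearIsometry.toLinearIsometryEquiv
    { toFun := fun x => !₂[Real.cos α * x 0 - Real.sin α * x 1,
        Real.sin α * x 0 + Real.cos α * x 1, x 2]
      map_add' := fun x y => by ext i; fin_cases i <;> simp <;> ring
      map_smul' := fun c x => by ext i; fin_cases i <;> simp <;> ring
      norm_map' := fun x => by
        rw [EuclideanSpace.norm_eq, EuclideanSpace.norm_eq, Fin.sum_univ_three, Fin.sum_univ_three]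
        congr 1
        simp only [Real.norm_eq_abs, sq_abs]
        simp
        linear_combination (x 0 ^ 2 + x 1 ^ 2) * Real.sin_sq_add_cos_sq α } rfl

theorem zRot_apply (α : ℝ) (x : E3) : zRot α x = !₂[Real.cos α * x 0 - Real.sin α * x 1,
    Real.sin α * x 0 + Real.cos α * x 1, x 2] := rfl

theorem height_zRot (α : ℝ) (x : S2) : height (sphereMap (zRot α) x) = height x := by
  simp [height_eq, zRot_apply]

theorem coordU_zRot (α : ℝ) (x : S2) :
    coordU (sphereMap (zRot α) x) = Complex.exp (α * Complex.I) * coordU x := by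
  rw [coordU_apply, coordU_apply, coe_sphereMap, zRot_apply, Complex.exp_mul_I]
  apply Complex.ext <;> simp [← Complex.ofReal_cos, ← Complex.ofReal_sin]
  ring

theorem azimuth_zRot (m : ℤ) (α : ℝ) (x : S2) :
    azimuth m (sphereMap (zRot α) x) = Complex.exp (m * α * Complex.I) * azimuth m x := by
  unfold azimuth
  split_ifs with h
  · obtain ⟨k, rfl⟩ := Int.eq_ofNat_of_zero_le h
    simp only [ContinuousMap.pow_apply, coordU_zRot, Int.natAbs_natCast]
    rw [mul_pow, ← Complex.exp_nat_mul]
    congr 2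
    push_cast
    ring
  · obtain ⟨k, rfl⟩ : ∃ k : ℕ, m = -k := ⟨m.natAbs, by omega⟩
    simp only [ContinuousMap.pow_apply, coordV_apply, coordU_zRot, Int.natAbs_neg,
      Int.natAbs_natCast]
    rw [map_mul, mul_pow, ← Complex.exp_conj, ← Complex.exp_nat_mul]
    congr 2
    simp
    ring

/-- Rotation by the angle `π / m` preserves the integral and changes the sign of `F`. -/
theorem integral_eq_zero_of_azimuthal {F : S2 → ℂ} {m : ℤ} (hm : m ≠ 0)
    (hF : ∀ α x, F (sphereMap (zRot α) x) = Complex.exp (m * α * Complex.I) * F x) :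
    ∫ x, F x ∂surfaceMeasure = 0 := by
  have h := integral_comp_sphereMap (zRot (Real.pi / m)) F
  have e : Complex.exp (m * ((Real.pi / m : ℝ) : ℂ) * Complex.I) = -1 := by
    have : (m : ℂ) ≠ 0 := by exact_mod_cast hm
    push_cast
    rw [mul_div_cancel₀ _ this, Complex.exp_pi_mul_I]
  simp only [hF, e] at h
  rw [integral_const_mul] at h
  linear_combination -h / 2

/-! ### Harmonic spaces and their orthogonality -/

/-- A continuous function as an element of `L²` of the sphere. -/
noncomputable abbrev toL2 : C(S2, ℂ) →L[ℂ] Lp ℂ 2 surfaceMeasure :=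
  ContinuousMap.toLp 2 surfaceMeasure ℂ

theorem inner_toL2 (f g : C(S2, ℂ)) :
    inner ℂ (toL2 f) (toL2 g) = ∫ x, g x * (starRingEnd ℂ) (f x) ∂surfaceMeasure :=
  ContinuousMap.inner_toLp _ f g

theorem inner_toL2_rotate (R : E3 ≃ₗᵢ[ℝ] E3) (f g : C(S2, ℂ)) :
    inner ℂ (toL2 (rotate R f)) (toL2 (rotate R g)) = inner ℂ (toL2 f) (toL2 g) := by
  rw [inner_toL2, inner_toL2]
  exact integral_comp_sphereMap R fun x => g x * (starRingEnd ℂ) (f x)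

/-- The spherical harmonics of degree `l`: the polynomial functions of degree at most `l` that are
orthogonal to all polynomial functions of smaller degree. -/
noncomputable def harmonicSpace (l : ℕ) : Submodule ℂ C(S2, ℂ) where
  carrier := {f | f ∈ polySpace l ∧ ∀ k < l, ∀ p ∈ polySpace k, inner ℂ (toL2 p) (toL2 f) = 0}
  add_mem' := fun ⟨h1, h2⟩ ⟨h3, h4⟩ => ⟨add_mem h1 h3, fun k hk p hp => by
    rw [map_add, inner_add_right, h2 k hk p hp, h4 k hk p hp, add_zero]⟩
  zero_mem' := ⟨zero_mem _, fun k hk p hp => by simp⟩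
  smul_mem' := fun c f ⟨h1, h2⟩ => ⟨Submodule.smul_mem _ c h1, fun k hk p hp => by
    rw [map_smul, inner_smul_right, h2 k hk p hp, mul_zero]⟩

theorem mem_harmonicSpace {l : ℕ} {f : C(S2, ℂ)} : f ∈ harmonicSpace l ↔
    f ∈ polySpace l ∧ ∀ k < l, ∀ p ∈ polySpace k, inner ℂ (toL2 p) (toL2 f) = 0 := Iff.rfl

theorem rotate_symm_rotate (R : E3 ≃ₗᵢ[ℝ] E3) (f : C(S2, ℂ)) :
    rotate R (rotate R.symm f) = f := by
  ext x
  rw [rotate_apply, rotate_apply]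
  congr 1
  exact Subtype.ext (by simp)

theorem rotate_mem_harmonicSpace (R : E3 ≃ₗᵢ[ℝ] E3) {l : ℕ} {f : C(S2, ℂ)}
    (hf : f ∈ harmonicSpace l) : rotate R f ∈ harmonicSpace l := by
  refine ⟨rotate_mem_polySpace R hf.1, fun k hk p hp => ?_⟩
  rw [← rotate_symm_rotate R p, inner_toL2_rotate]
  exact hf.2 k hk _ (rotate_mem_polySpace _ hp)

theorem inner_harmonicSpace_of_ne {k l : ℕ} (hkl : k ≠ l) {f g : C(S2, ℂ)}
    (hf : f ∈ harmonicSpace k) (hg : g ∈ harmonicSpace l) : inner ℂ (toL2 f) (toL2 g) = 0 := by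
  rcases hkl.lt_or_gt with h | h
  · exact hg.2 k h f hf.1
  · rw [← inner_conj_symm, hf.2 l h g hg.1, map_zero]

theorem inner_azimuth_mul (m m' : ℤ) (p q : ℝ[X]) :
    inner ℂ (toL2 (azimuth m' * aeval coordZ p)) (toL2 (azimuth m * aeval coordZ q)) =
      if m = m' then ((2 * Real.pi * ∫ t in (-1 : ℝ)..1,
        ((1 - X ^ 2) ^ m.natAbs * q * p).eval t : ℝ) : ℂ) else 0 := by
  rw [inner_toL2]
  split_ifs with h
  · subst h
    rw [← integral_height_eval, ← integral_complex_ofReal]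
    congr 1
    ext x
    simp only [ContinuousMap.mul_apply, aeval_coordZ_apply, map_mul, Complex.conj_ofReal]
    rw [mul_mul_mul_comm, azimuth_mul_conj]
    simp only [eval_mul, eval_pow, eval_sub, eval_one, eval_X]
    push_cast
    ring
  · refine integral_eq_zero_of_azimuthal (sub_ne_zero.2 h) fun α x => ?_
    simp only [ContinuousMap.mul_apply, aeval_coordZ_apply, map_mul, Complex.conj_ofReal,
      azimuth_zRot, height_zRot, ← Complex.exp_conj, Complex.conj_I, map_intCast]
    rw [show ((m - m' : ℤ) : ℂ) * α * Complex.I =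
      m * α * Complex.I + m' * α * -Complex.I by push_cast; ring, Complex.exp_add]
    ring

/-! ### Polar factors and the explicit spherical harmonics -/

/-- `q` has degree `l - |m|` and is orthogonal to the polynomials of smaller degree for the weight
`(1 - t ^ 2) ^ |m|`, as is the factor of a spherical harmonic that depends on the height. -/
def IsPolarFactor (l : ℕ) (m : ℤ) (q : ℝ[X]) : Prop :=
  q.natDegree ≤ l - m.natAbs ∧ q.coeff (l - m.natAbs) ≠ 0 ∧
    ∀ r : ℝ[X], r.natDegree < l - m.natAbs →
      ∫ t in (-1 : ℝ)..1, ((1 - X ^ 2) ^ m.natAbs * q * r).eval t = 0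

/-- Among the spanning monomials of degree below `l` only those of the same order `m` can fail to be
orthogonal for azimuthal reasons, and their power of `z` is below `l - |m|`. -/
theorem IsPolarFactor.mem_harmonicSpace {l : ℕ} {m : ℤ} (hm : m.natAbs ≤ l) {q : ℝ[X]}
    (hq : IsPolarFactor l m q) : azimuth m * aeval coordZ q ∈ harmonicSpace l := by
  refine ⟨?_, fun k hk p hp => ?_⟩
  · have := mul_mem_polySpace (azimuth_mem m) (aeval_coordZ_mem q hq.1)
    rwa [Nat.add_sub_cancel' hm] at this
  · rw [polySpace_eq_span] at hp
    induction hp using Submodule.span_induction with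
    | mem p hp =>
      obtain ⟨m', j, hmj, rfl⟩ := hp
      rw [← aeval_X_pow (R := ℝ), inner_azimuth_mul]
      split_ifs with h
      · subst h
        rw [hq.2.2 _ (by rw [natDegree_X_pow]; omega)]
        simp
      · rfl
    | zero => simp
    | add p p' _ _ h1 h2 => rw [map_add, inner_add_left, h1, h2, add_zero]
    | smul c p _ h => rw [map_smul, inner_smul_left, h, mul_zero]

theorem natDegree_one_sub_sq_pow (l : ℕ) : ((1 - X ^ 2 : ℝ[X]) ^ l).natDegree = 2 * l := by
  rw [natDegree_pow, show (1 - X ^ 2 : ℝ[X]) = -X ^ 2 + C 1 by simp; ring, natDegree_add_C,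
    natDegree_neg, natDegree_X_pow, mul_comm]

theorem coeff_iterate_derivative_ne_zero {p : ℝ[X]} {n : ℕ} (hp : p ≠ 0) (hn : n ≤ p.natDegree) :
    (derivative^[n] p).coeff (p.natDegree - n) ≠ 0 := by
  rw [coeff_iterate_derivative, Nat.sub_add_cancel hn, nsmul_eq_mul]
  refine mul_ne_zero ?_ (leadingCoeff_ne_zero.2 hp)
  exact_mod_cast (Nat.pos_of_ne_zero (mt Nat.descFactorial_eq_zero_iff_lt.1 (by omega))).ne'

theorem natDegree_iterate_derivative_eq {p : ℝ[X]} {n : ℕ} (hp : p ≠ 0) (hn : n ≤ p.natDegree) :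
    (derivative^[n] p).natDegree = p.natDegree - n :=
  natDegree_eq_of_le_of_coeff_ne_zero (natDegree_iterate_derivative _ _)
    (coeff_iterate_derivative_ne_zero hp hn)

theorem one_sub_sq_ne_zero : (1 - X ^ 2 : ℝ[X]) ≠ 0 := fun h => by
  have := congrArg (eval 0) h
  simp at this

theorem dvd_iterate_derivative_one_sub_sq_pow {l n : ℕ} (h : n < l) :
    (1 - X ^ 2 : ℝ[X]) ∣ derivative^[n] ((1 - X ^ 2) ^ l) :=
  (dvd_pow_self _ (by omega)).trans (pow_sub_dvd_iterate_derivative_pow _ l n)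

theorem isPolarFactor_nonneg (l k : ℕ) (hk : k ≤ l) :
    IsPolarFactor l k (derivative^[k + l] ((1 - X ^ 2) ^ l)) := by
  have hne : ((1 - X ^ 2 : ℝ[X]) ^ l) ≠ 0 := pow_ne_zero _ one_sub_sq_ne_zero
  have hn : k + l ≤ ((1 - X ^ 2 : ℝ[X]) ^ l).natDegree := by
    rw [natDegree_one_sub_sq_pow]; omega
  have hd := natDegree_iterate_derivative_eq hne hn
  have hc := coeff_iterate_derivative_ne_zero hne hn
  rw [natDegree_one_sub_sq_pow, show 2 * l - (k + l) = l - k by omega] at hd hc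
  refine ⟨by simpa using hd.le, by simpa using hc, fun r hr => ?_⟩
  rw [Int.natAbs_natCast] at hr ⊢
  have h := integral_iterate_derivative_mul (k + l) ((1 - X ^ 2) ^ l) ((1 - X ^ 2) ^ k * r)
    fun i hi => by
      -- Boundary terms: either fewer than `l` derivatives hit `(1 - X ^ 2) ^ l`, or fewer than `k`
      -- hit `(1 - X ^ 2) ^ k * r`.
      by_cases h : k + l - 1 - i < l
      · exact Dvd.dvd.mul_right (dvd_iterate_derivative_one_sub_sq_pow h) _
      · refine Dvd.dvd.mul_left ?_ _
        have := pow_sub_dvd_iterate_derivative_of_pow_dvd i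
          (dvd_mul_right ((1 - X ^ 2 : ℝ[X]) ^ k) r)
        exact (dvd_pow_self _ (by omega)).trans this
  have hz : derivative^[k + l] ((1 - X ^ 2) ^ k * r) = 0 := by
    refine iterate_derivative_eq_zero (natDegree_mul_le.trans_lt ?_)
    rw [natDegree_one_sub_sq_pow]
    omega
  rw [hz] at h
  simp only [eval_zero, mul_zero, intervalIntegral.integral_zero] at h
  rw [← h]
  congr 1
  ext t
  simp only [eval_mul]
  ring

theorem exists_isPolarFactor_neg (l k : ℕ) (hk : k ≤ l) :
    ∃ q, derivative^[l - k] ((1 - X ^ 2 : ℝ[X]) ^ l) = (1 - X ^ 2) ^ k * q ∧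
      IsPolarFactor l (-k) q := by
  have hne : ((1 - X ^ 2 : ℝ[X]) ^ l) ≠ 0 := pow_ne_zero _ one_sub_sq_ne_zero
  have hn : l - k ≤ ((1 - X ^ 2 : ℝ[X]) ^ l).natDegree := by
    rw [natDegree_one_sub_sq_pow]; omega
  have hd := natDegree_iterate_derivative_eq hne hn
  have hdvd := pow_sub_dvd_iterate_derivative_pow (1 - X ^ 2 : ℝ[X]) l (l - k)
  rw [show l - (l - k) = k by omega] at hdvd
  obtain ⟨q, hq⟩ := hdvd
  have hq0 : q ≠ 0 := by
    rintro rfl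
    have hc := coeff_iterate_derivative_ne_zero hne hn
    rw [hq] at hc
    simp at hc
  rw [natDegree_one_sub_sq_pow, hq, natDegree_mul (pow_ne_zero _ one_sub_sq_ne_zero) hq0,
    natDegree_one_sub_sq_pow] at hd
  have hdq : q.natDegree = l - k := by omega
  refine ⟨q, hq, ?_, ?_, fun r hr => ?_⟩
  · simpa using hdq.le
  · rw [Int.natAbs_neg, Int.natAbs_natCast, ← hdq]
    exact leadingCoeff_ne_zero.2 hq0
  · rw [Int.natAbs_neg, Int.natAbs_natCast] at hr ⊢
    have h := integral_iterate_derivative_mul (l - k) ((1 - X ^ 2) ^ l) r fun i hi =>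
      Dvd.dvd.mul_right (dvd_iterate_derivative_one_sub_sq_pow (by omega)) _
    rw [iterate_derivative_eq_zero hr, hq] at h
    simp only [eval_zero, mul_zero, intervalIntegral.integral_zero] at h
    rw [← h]
    simp only [eval_mul]

theorem isPolarFactor_legendre (l : ℕ) : IsPolarFactor l 0 (legendre l) := by
  obtain ⟨h1, h2, h3⟩ := isPolarFactor_nonneg l 0 l.zero_le
  rw [zero_add] at h1 h2 h3
  simp only [Nat.cast_zero, Int.natAbs_zero, Nat.sub_zero] at h1 h2 h3
  refine ⟨?_, ?_, fun r hr => ?_⟩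
  · exact (natDegree_C_mul_le _ _).trans h1
  · rw [legendre, coeff_C_mul]
    exact mul_ne_zero (by positivity) h2
  · have := h3 r hr
    simp only [Int.natAbs_zero, pow_zero, one_mul, legendre, eval_mul, eval_C, mul_assoc] at this ⊢
    rw [intervalIntegral.integral_const_mul, this, mul_zero]

theorem norm_coordU_pow_eq_rpow (x : S2) (k : ℕ) :
    (1 - ((x : E3) 2) ^ 2) ^ (((k : ℤ) : ℝ) / 2) = ‖coordU x‖ ^ k := by
  rw [← height_eq, ← norm_coordU_sq, ← Real.rpow_natCast, ← Real.rpow_mul (norm_nonneg _)]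
  push_cast
  rw [mul_div_cancel₀ _ two_ne_zero, Real.rpow_natCast]

/-- For order `-k` the associated Legendre function has the singular factor `(1 - z²)^(-k/2)`; the
factor `(1 - z²)^k` split off in `exists_isPolarFactor_neg` compensates it. At the poles both sides
vanish when `k > 0`. -/
theorem rpow_neg_mul_norm_coordU (x : S2) (k : ℕ) :
    (1 - ((x : E3) 2) ^ 2) ^ (((-(k : ℤ) : ℤ) : ℝ) / 2) * (1 - ((x : E3) 2) ^ 2) ^ k =
      ‖coordU x‖ ^ k := by
  rcases Nat.eq_zero_or_pos k with rfl | hk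
  · simp
  rw [← norm_coordU_pow_eq_rpow, ← height_eq, ← norm_coordU_sq]
  push_cast
  rw [neg_div, Real.rpow_neg (by positivity)]
  rcases eq_or_ne ‖coordU x‖ 0 with h | h
  · rw [h]
    have : (k : ℝ) / 2 ≠ 0 := by positivity
    simp [Real.zero_rpow this, hk.ne']
  · have h2 : (0 : ℝ) < ‖coordU x‖ ^ 2 := by positivity
    rw [inv_mul_eq_iff_eq_mul₀ (Real.rpow_pos_of_pos h2 _).ne', ← Real.rpow_add h2, add_halves,
      Real.rpow_natCast]

theorem azimuth_eq_norm_mul_exp (m : ℤ) (x : S2) : azimuth m x = (‖coordU x‖ : ℂ) ^ m.natAbs *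
    Complex.exp (Complex.I * m * (Complex.arg ⟨(x : E3) 0, (x : E3) 1⟩ : ℂ)) := by
  have h := Complex.norm_mul_exp_arg_mul_I (coordU x)
  rw [← coordU_apply]
  unfold azimuth
  split_ifs with hm
  · obtain ⟨k, rfl⟩ := Int.eq_ofNat_of_zero_le hm
    rw [ContinuousMap.pow_apply, Int.natAbs_natCast]
    nth_rw 1 [← h]
    rw [mul_pow, ← Complex.exp_nat_mul]
    congr 2
    push_cast
    ring
  · obtain ⟨k, rfl⟩ : ∃ k : ℕ, m = -k := ⟨m.natAbs, by omega⟩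
    rw [ContinuousMap.pow_apply, Int.natAbs_neg, Int.natAbs_natCast, coordV_apply]
    nth_rw 1 [← h]
    rw [map_mul, ← Complex.exp_conj, mul_pow, ← Complex.exp_nat_mul, Complex.conj_ofReal]
    congr 2
    simp
    ring

/-- The spherical harmonics in Cartesian coordinates. -/
theorem exists_sphericalHarmonic_eq (l : ℕ) (m : ℤ) (hm : |m| ≤ (l : ℤ)) :
    ∃ (c : ℂ) (q : ℝ[X]), c ≠ 0 ∧ IsPolarFactor l m q ∧
      ∀ x, sphericalHarmonic l m x = (c • (azimuth m * aeval coordZ q)) x := by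
  have hml : m.natAbs ≤ l := by rw [Int.abs_eq_natAbs] at hm; omega
  obtain ⟨q, hq, hqx⟩ : ∃ q : ℝ[X], IsPolarFactor l m q ∧ ∀ x : S2,
      (1 - ((x : E3) 2) ^ 2) ^ ((m : ℝ) / 2) *
        (derivative^[(m + (l : ℤ)).toNat] ((1 - X ^ 2) ^ l : ℝ[X])).eval ((x : E3) 2) =
      ‖coordU x‖ ^ m.natAbs * q.eval (height x) := by
    rcases le_or_gt 0 m with h | h
    · obtain ⟨k, rfl⟩ := Int.eq_ofNat_of_zero_le h
      refine ⟨_, isPolarFactor_nonneg l k (by simpa using hml), fun x => ?_⟩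
      rw [norm_coordU_pow_eq_rpow, Int.natAbs_natCast, height_eq,
        show ((k : ℤ) + (l : ℤ)).toNat = k + l by omega]
    · obtain ⟨k, rfl⟩ : ∃ k : ℕ, m = -k := ⟨m.natAbs, by omega⟩
      obtain ⟨q, hq, hq'⟩ := exists_isPolarFactor_neg l k (by simpa using hml)
      refine ⟨q, hq', fun x => ?_⟩
      rw [show (-(k : ℤ) + (l : ℤ)).toNat = l - k by omega, hq, eval_mul, ← mul_assoc, height_eq]
      simp only [eval_pow, eval_sub, eval_one, eval_X]
      rw [rpow_neg_mul_norm_coordU, Int.natAbs_neg, Int.natAbs_natCast]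
  refine ⟨(Real.sqrt ((2 * (l : ℝ) + 1) / (4 * Real.pi) *
      ((((l : ℤ) - m).toNat.factorial : ℝ) / (((l : ℤ) + m).toNat.factorial : ℝ))) : ℂ) *
      (((-1) ^ (m + (l : ℤ)).toNat / (2 ^ l * (l.factorial : ℝ)) : ℝ) : ℂ), q, ?_, hq,
      fun x => ?_⟩
  · refine mul_ne_zero ?_ ?_
    · have := Real.pi_pos
      exact_mod_cast (Real.sqrt_pos.2 (by positivity)).ne'
    · exact Complex.ofReal_ne_zero.2 (by positivity)
  · rw [sphericalHarmonic, assocLegendre, mul_assoc _ (_ ^ _) (eval _ _), hqx]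
    simp only [ContinuousMap.smul_apply, ContinuousMap.mul_apply, aeval_coordZ_apply,
      azimuth_eq_norm_mul_exp, smul_eq_mul]
    push_cast
    ring

/-! ### Harmonic decomposition and completeness -/

/-- A subspace contains all polynomial functions of degree at most `l` as soon as it contains those
of smaller degree and one spherical harmonic of each order. -/
theorem polySpace_le_of_polarFactor {l : ℕ} {U : Submodule ℂ C(S2, ℂ)}
    (hlow : ∀ k < l, polySpace k ≤ U)
    (hY : ∀ m : ℤ, m.natAbs ≤ l → ∃ q, IsPolarFactor l m q ∧ azimuth m * aeval coordZ q ∈ U) :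
    polySpace l ≤ U := by
  rw [polySpace_eq_span, Submodule.span_le]
  rintro _ ⟨m, j, hmj, rfl⟩
  have hsmall : ∀ i, m.natAbs + i < l → azimuth m * coordZ ^ i ∈ U := fun i hi =>
    hlow _ hi (mul_mem_polySpace (azimuth_mem m) (coordZ_pow_mem i))
  rcases hmj.lt_or_eq with h | h
  · exact hsmall j h
  obtain ⟨q, ⟨hq1, hq2, -⟩, hq⟩ := hY m (by omega)
  rw [show l - m.natAbs = j by omega] at hq1 hq2
  rw [aeval_eq_sum_range' (Nat.lt_succ_of_le hq1), Finset.sum_range_succ, mul_add] at hq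
  have hsmul : ∀ i, azimuth m * q.coeff i • coordZ ^ i =
      (q.coeff i : ℂ) • (azimuth m * coordZ ^ i) := fun i => by
    ext x
    simp only [ContinuousMap.mul_apply, ContinuousMap.smul_apply, Complex.real_smul, smul_eq_mul]
    ring
  have hsum : azimuth m * ∑ i ∈ Finset.range j, q.coeff i • coordZ ^ i ∈ U := by
    rw [Finset.mul_sum]
    refine Submodule.sum_mem _ fun i hi => ?_
    rw [hsmul]
    exact Submodule.smul_mem _ _ (hsmall i (by have := Finset.mem_range.1 hi; omega))
  -- Only the top term of `q` is left, and its coefficient is nonzero.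
  rw [Submodule.add_mem_iff_right _ hsum, hsmul] at hq
  exact (Submodule.smul_mem_iff _ (by exact_mod_cast hq2)).1 hq

theorem exists_sum_harmonic {L : ℕ} {p : C(S2, ℂ)} (hp : p ∈ polySpace L) :
    ∃ c : ℕ → C(S2, ℂ), (∀ l, c l ∈ harmonicSpace l) ∧ p = ∑ l ∈ Finset.range (L + 1), c l := by
  have key : polySpace L ≤ ⨆ l ∈ Finset.range (L + 1), harmonicSpace l := by
    induction L using Nat.strong_induction_on generalizing p with
    | _ L ih =>
      refine polySpace_le_of_polarFactor (fun k hk => ?_) fun m hm => ?_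
      · refine (ih k hk (zero_mem _)).trans (biSup_mono fun i hi => ?_)
        simp only [Finset.mem_range] at hi ⊢
        omega
      · obtain ⟨-, q, -, hq, -⟩ := exists_sphericalHarmonic_eq L m
          (by rw [Int.abs_eq_natAbs]; omega)
        exact ⟨q, hq, Submodule.mem_iSup_of_mem L (Submodule.mem_iSup_of_mem (by simp)
          (hq.mem_harmonicSpace hm))⟩
  obtain ⟨μ, hμ⟩ := (Submodule.mem_iSup_finset_iff_exists_sum _ _).1 (key hp)
  exact ⟨fun l => μ l, fun l => (μ l).2, hμ.symm⟩

/-- The polynomial functions on the sphere. -/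
noncomputable def polyAlgebra : StarSubalgebra ℂ C(S2, ℂ) where
  carrier := {f | ∃ N, f ∈ polySpace N}
  mul_mem' := fun ⟨_, h1⟩ ⟨_, h2⟩ => ⟨_, mul_mem_polySpace h1 h2⟩
  add_mem' := fun ⟨m, h1⟩ ⟨n, h2⟩ => ⟨max m n,
    add_mem (polySpace_mono (le_max_left m n) h1) (polySpace_mono (le_max_right m n) h2)⟩
  algebraMap_mem' := fun r => ⟨0, by
    rw [Algebra.algebraMap_eq_smul_one]
    exact Submodule.smul_mem _ _ (Submodule.one_le.1 polySpace_zero.ge)⟩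
  star_mem' := by
    rintro f ⟨N, hf⟩
    refine ⟨N, ?_⟩
    rw [polySpace_eq_span] at hf
    induction hf using Submodule.span_induction with
    | mem f h =>
      obtain ⟨m, j, hmj, rfl⟩ := h
      have e : star (azimuth m * coordZ ^ j) = azimuth (-m) * coordZ ^ j := by
        ext x
        simp only [ContinuousMap.star_apply, ContinuousMap.mul_apply, ContinuousMap.pow_apply,
          star_mul', star_pow, coordZ_apply, azimuth]
        simp only [RCLike.star_def, Complex.conj_ofReal]
        congr 1
        rcases lt_trichotomy m 0 with h | h | h
        · rw [if_neg (by omega), if_pos (by omega), Int.natAbs_neg, ContinuousMap.pow_apply,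
            ContinuousMap.pow_apply, coordV_apply, map_pow, Complex.conj_conj]
        · simp [h]
        · rw [if_pos (by omega), if_neg (by omega), Int.natAbs_neg, ContinuousMap.pow_apply,
            ContinuousMap.pow_apply, coordV_apply, map_pow]
      rw [e]
      refine polySpace_mono hmj ?_
      rw [← Int.natAbs_neg]
      exact mul_mem_polySpace (azimuth_mem _) (coordZ_pow_mem j)
    | zero => simp
    | add f g _ _ h1 h2 => exact star_add f g ▸ add_mem h1 h2
    | smul c f _ h => exact star_smul c f ▸ Submodule.smul_mem _ _ h

theorem polyAlgebra_separatesPoints : polyAlgebra.SeparatesPoints := by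
  intro x y hxy
  refine ⟨coordFn ((x : E3) - y), ⟨coordFn ((x : E3) - y), ⟨1, ?_⟩, rfl⟩, fun h => hxy ?_⟩
  · simpa using pow_mem_polySpace (coordFn_mem ((x : E3) - y)) 1
  · rw [coordFn_apply, coordFn_apply, Complex.ofReal_inj, ← sub_eq_zero, ← inner_sub_right,
      inner_self_eq_zero, sub_eq_zero] at h
    exact Subtype.ext h

/-- Stone–Weierstrass gives uniform density, and continuous functions are dense in `L²`. -/
theorem dense_toL2_polyAlgebra : Dense (toL2 '' (polyAlgebra : Set C(S2, ℂ))) := by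
  have h1 := ContinuousMap.starSubalgebra_topologicalClosure_eq_top_of_separatesPoints
    polyAlgebra polyAlgebra_separatesPoints
  have h2 : Dense (polyAlgebra : Set C(S2, ℂ)) := by
    rw [dense_iff_closure_eq, ← StarSubalgebra.topologicalClosure_coe, h1]
    rfl
  exact (ContinuousMap.toLp_denseRange ℂ surfaceMeasure ℂ (by simp)).dense_image
    toL2.continuous h2

theorem inner_toLp_eq_integral {f g : S2 → ℂ} (hf : MemLp f 2 surfaceMeasure)
    (hg : MemLp g 2 surfaceMeasure) : inner ℂ (hf.toLp f) (hg.toLp g) =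
      ∫ x, g x * (starRingEnd ℂ) (f x) ∂surfaceMeasure := by
  rw [L2.inner_def]
  refine integral_congr_ae ?_
  filter_upwards [hf.coeFn_toLp, hg.coeFn_toLp] with x h1 h2
  rw [h1, h2]
  simp

theorem memLp_continuousMap (f : C(S2, ℂ)) : MemLp f 2 surfaceMeasure := f.memLp surfaceMeasure ℂ

theorem toL2_eq_toLp (f : C(S2, ℂ)) : toL2 f = (memLp_continuousMap f).toLp f :=
  Lp.ext ((ContinuousMap.coeFn_toLp surfaceMeasure f).trans (MemLp.coeFn_toLp _).symm)

instance (N : ℕ) : FiniteDimensional ℂ (polySpace N) := by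
  rw [polySpace_eq_span]
  refine FiniteDimensional.span_of_finite ℂ (Set.Finite.subset
    (Set.Finite.image2 (fun (m : ℤ) (j : ℕ) => azimuth m * coordZ ^ j)
      (Set.finite_Icc (-(N : ℤ)) N) (Set.finite_Iic N)) ?_)
  rintro _ ⟨m, j, hmj, rfl⟩
  exact ⟨m, Set.mem_Icc.2 (by omega), j, Set.mem_Iic.2 (by omega), rfl⟩

/-- Completeness of the spherical harmonics: a band-limited function is a polynomial function. -/
theorem exists_polySpace_ae_eq {L : ℕ} {h : S2 → ℂ} (hh : h ∈ bandLimited L) :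
    ∃ p ∈ polySpace L, h =ᵐ[surfaceMeasure] p := by
  obtain ⟨hmem, hcoeff⟩ := hh
  set v := hmem.toLp h
  obtain ⟨_, ⟨p, hp, rfl⟩, w, hw, hvw⟩ :=
    ((polySpace L).map toL2.toLinearMap).exists_add_mem_mem_orthogonal v
  change v = toL2 p + w at hvw
  have hw' : ∀ f ∈ polySpace L, inner ℂ (toL2 f) w = 0 := fun f hf =>
    (Submodule.mem_orthogonal _ _).1 hw _ ⟨f, hf, rfl⟩
  let U : Submodule ℂ C(S2, ℂ) :=
    { carrier := {f | inner ℂ (toL2 f) w = 0}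
      add_mem' := fun {f g} h1 h2 => by
        rw [Set.mem_ofPred_eq] at h1 h2 ⊢
        rw [map_add, inner_add_left, h1, h2, add_zero]
      zero_mem' := by simp
      smul_mem' := fun c f h1 => by
        rw [Set.mem_ofPred_eq] at h1 ⊢
        rw [map_smul, inner_smul_left, h1, mul_zero] }
  -- The remainder `w` is orthogonal to degree at most `L` by projection. In higher degree each
  -- harmonic is orthogonal to `h`, whose coefficient vanishes, and to `p` by degree, hence to `w`.
  have hU : ∀ N, polySpace N ≤ U := by
    intro N
    induction N using Nat.strong_induction_on with
    | _ N ih =>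
      by_cases hN : N ≤ L
      · exact fun f hf => hw' f (polySpace_mono hN hf)
      refine polySpace_le_of_polarFactor ih fun m hm => ?_
      have hm' : |m| ≤ (N : ℤ) := by rw [Int.abs_eq_natAbs]; omega
      obtain ⟨c, q, hc, hq, hY⟩ := exists_sphericalHarmonic_eq N m hm'
      refine ⟨q, hq, ?_⟩
      have hmemY := hq.mem_harmonicSpace hm
      set Y := azimuth m * aeval coordZ q
      have h1 : inner ℂ (toL2 (c • Y)) v = 0 := by
        rw [toL2_eq_toLp, inner_toLp_eq_integral, ← hcoeff N m (by omega) hm', coeff]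
        simp only [hY]
      have h2 : inner ℂ (toL2 Y) (toL2 p) = 0 := by
        rw [← inner_conj_symm, hmemY.2 L (by omega) p hp, map_zero]
      rw [map_smul, inner_smul_left, hvw, inner_add_right, h2, zero_add] at h1
      exact (mul_eq_zero.1 h1).resolve_left (by simpa using hc)
  have hw0 : w = 0 := by
    refine dense_toL2_polyAlgebra.eq_zero_of_inner_right ℂ ?_
    rintro _ ⟨f, ⟨N, hf⟩, rfl⟩
    exact hU N hf
  refine ⟨p, hp, ?_⟩
  rw [hw0, add_zero, toL2_eq_toLp] at hvw
  exact (MemLp.toLp_eq_toLp_iff _ _).1 hvw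

theorem aeval_legendre_mem_harmonicSpace (l : ℕ) :
    aeval coordZ (legendre l) ∈ harmonicSpace l := by
  have := (isPolarFactor_legendre l).mem_harmonicSpace (by simp)
  simpa [azimuth] using this

theorem aeval_legendre_mem_bandLimited (L : ℕ) :
    ⇑(aeval coordZ (legendre L) : C(S2, ℂ)) ∈ bandLimited L := by
  refine ⟨memLp_continuousMap _, fun l m hl hm => ?_⟩
  obtain ⟨c, q, -, hq, hY⟩ := exists_sphericalHarmonic_eq l m hm
  have h := hq.mem_harmonicSpace (by rw [Int.abs_eq_natAbs] at hm; omega)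
  have h0 := h.2 L hl _ (aeval_legendre_mem_harmonicSpace L).1
  rw [← inner_conj_symm, map_eq_zero, inner_toL2] at h0
  simp only [coeff, hY, ContinuousMap.smul_apply, ContinuousMap.mul_apply, smul_eq_mul, map_mul]
  simp only [ContinuousMap.mul_apply, map_mul] at h0
  rw [← mul_zero ((starRingEnd ℂ) c), ← h0, ← integral_const_mul]
  congr 1
  ext x
  ring

/-! ### The Funk–Hecke formula -/

/-- The eigenvalue of the convolution with a zonal function on the spherical harmonics of
degree `l`. -/
noncomputable def multiplier (g : S2 → ℂ) (l : ℕ) : ℂ :=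
  ∫ x, (((legendre l).eval (height x) : ℝ) : ℂ) * g x ∂surfaceMeasure

theorem integrable_continuousMap_mul (f : C(S2, ℂ)) {g : S2 → ℂ}
    (hg : MemLp g 2 surfaceMeasure) : Integrable (fun x => f x * g x) surfaceMeasure :=
  MemLp.integrable_mul (memLp_continuousMap f) hg

theorem azimuth_northPole {m : ℤ} (hm : m ≠ 0) : azimuth m northPole = 0 := by
  have h := azimuth_mul_conj m northPole
  rw [northPole_height] at h
  have : m.natAbs ≠ 0 := by omega
  simpa [this] using h

/-- Funk–Hecke at the north pole. Harmonics of order `m ≠ 0` vanish at the pole and integrate to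
zero against zonal functions; for `P_l(z)` the claim is the definition of the multiplier with
`P_l(1) = 1`. -/
theorem integral_harmonic_mul_zonal {l : ℕ} {f : C(S2, ℂ)} (hf : f ∈ harmonicSpace l)
    {g : S2 → ℂ} (hg : MemLp g 2 surfaceMeasure) (hz : IsZonal g) :
    ∫ x, f x * g x ∂surfaceMeasure = multiplier g l * f northPole := by
  set S : Submodule ℂ C(S2, ℂ) := Submodule.span ℂ {f | f = aeval coordZ (legendre l) ∨
    ∃ (m : ℤ) (q : ℝ[X]), m ≠ 0 ∧ m.natAbs ≤ l ∧ IsPolarFactor l m q ∧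
      f = azimuth m * aeval coordZ q}
  let T : Submodule ℂ C(S2, ℂ) :=
    { carrier := {p | ∀ f ∈ harmonicSpace l, inner ℂ (toL2 p) (toL2 f) = 0}
      add_mem' := fun {p q} h1 h2 f hf => by
        rw [map_add, inner_add_left, h1 f hf, h2 f hf, add_zero]
      zero_mem' := by simp
      smul_mem' := fun c f h1 f hf => by
        rw [map_smul, inner_smul_left, h1 f hf, mul_zero] }
  have hST : polySpace l ≤ S ⊔ T := by
    refine polySpace_le_of_polarFactor
      (fun k hk p hp => Submodule.mem_sup_right fun f hf => hf.2 k hk p hp) fun m hm => ?_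
    rcases eq_or_ne m 0 with rfl | h0
    · refine ⟨_, isPolarFactor_legendre l, Submodule.mem_sup_left (Submodule.subset_span ?_)⟩
      left
      simp [azimuth]
    · obtain ⟨-, q, -, hq, -⟩ := exists_sphericalHarmonic_eq l m
          (by rw [Int.abs_eq_natAbs]; omega)
      exact ⟨q, hq, Submodule.mem_sup_left (Submodule.subset_span (Or.inr ⟨m, q, h0, hm, hq, rfl⟩))⟩
  have hSH : S ≤ harmonicSpace l := by
    rw [Submodule.span_le]
    rintro _ (rfl | ⟨m, q, -, hm, hq, rfl⟩)
    exacts [aeval_legendre_mem_harmonicSpace l, hq.mem_harmonicSpace hm]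
  -- The component of `f` in `T` is itself harmonic of degree `l`, hence orthogonal to itself.
  have hfS : f ∈ S := by
    obtain ⟨s, hs, p, hp, rfl⟩ := Submodule.mem_sup.1 (hST hf.1)
    have hpH : p ∈ harmonicSpace l := by simpa using sub_mem hf (hSH hs)
    have h0 := inner_self_eq_zero.1 (hp p hpH)
    have : p = 0 := ContinuousMap.toLp_injective (p := 2) (𝕜 := ℂ) surfaceMeasure
      (h0.trans (map_zero toL2).symm)
    rw [this, add_zero]
    exact hs
  clear hf
  induction hfS using Submodule.span_induction with
  | mem f h =>
    rcases h with rfl | ⟨m, q, hm0, -, -, rfl⟩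
    · simp only [aeval_coordZ_apply, northPole_height, legendre_eval_one, multiplier]
      simp
    · rw [ContinuousMap.mul_apply, azimuth_northPole hm0, zero_mul, mul_zero]
      refine integral_eq_zero_of_azimuthal hm0 fun α x => ?_
      simp only [ContinuousMap.mul_apply, aeval_coordZ_apply, azimuth_zRot, height_zRot,
        hz _ _ (height_zRot α x)]
      ring
  | zero => simp
  | add f f' _ _ h1 h2 =>
    simp only [ContinuousMap.add_apply, add_mul, mul_add]
    rw [integral_add (integrable_continuousMap_mul f hg) (integrable_continuousMap_mul f' hg),
      h1, h2]
  | smul c f _ h =>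
    simp only [ContinuousMap.smul_apply, smul_eq_mul, mul_assoc]
    rw [integral_const_mul, h]
    ring

theorem profile_inner_sphereMap {g : S2 → ℂ} (hz : IsZonal g) (R : E3 ≃ₗᵢ[ℝ] E3) (y : S2) :
    profile g (inner ℝ (sphereMap R northPole : E3) (sphereMap R y : E3)) = g y := by
  rw [coe_sphereMap, coe_sphereMap, R.inner_map_map, real_inner_comm]
  exact profile_height hz y

/-- The Funk–Hecke formula. -/
theorem conv_harmonic {l : ℕ} {f : C(S2, ℂ)} (hf : f ∈ harmonicSpace l)
    {g : S2 → ℂ} (hg : MemLp g 2 surfaceMeasure) (hz : IsZonal g) (x : S2) :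
    conv f g x = multiplier g l * f x := by
  -- An isometry moves `x` to the pole, and `harmonicSpace l` is invariant under it.
  obtain ⟨R, rfl⟩ := exists_isometry_northPole x
  rw [conv, ← integral_comp_sphereMap R]
  simp only [profile_inner_sphereMap hz]
  exact integral_harmonic_mul_zonal (rotate_mem_harmonicSpace R hf) hg hz

theorem integrable_mul_profile (f : C(S2, ℂ)) {g : S2 → ℂ} (hg : MemLp g 2 surfaceMeasure)
    (hz : IsZonal g) (x : S2) :
    Integrable (fun y => f y * profile g (inner ℝ (x : E3) (y : E3))) surfaceMeasure := by
  obtain ⟨R, rfl⟩ := exists_isometry_northPole x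
  rw [← (measurePreserving_sphereMap R).integrable_comp_emb
    (sphereHomeomorph R).measurableEmbedding]
  simp only [Function.comp_def, profile_inner_sphereMap hz]
  exact integrable_continuousMap_mul (rotate R f) hg

theorem conv_sum_harmonic {s : Finset ℕ} {c : ℕ → C(S2, ℂ)} (hc : ∀ l, c l ∈ harmonicSpace l)
    {h : S2 → ℂ} (hh : h =ᵐ[surfaceMeasure] ⇑(∑ l ∈ s, c l))
    {g : S2 → ℂ} (hg : MemLp g 2 surfaceMeasure) (hz : IsZonal g) :
    conv h g = ⇑(∑ l ∈ s, multiplier g l • c l) := by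
  ext x
  calc conv h g x
      = ∫ y, ∑ l ∈ s, c l y * profile g (inner ℝ (x : E3) (y : E3)) ∂surfaceMeasure := by
        refine integral_congr_ae ?_
        filter_upwards [hh] with y hy
        rw [hy, ContinuousMap.sum_apply, Finset.sum_mul]
    _ = ∑ l ∈ s, conv (c l) g x := integral_finsetSum _ fun l _ => integrable_mul_profile _ hg hz x
    _ = _ := by
        rw [ContinuousMap.sum_apply]
        exact Finset.sum_congr rfl fun l _ => conv_harmonic (hc l) hg hz x

theorem norm_toL2_sum_sq {s : Finset ℕ} {c : ℕ → C(S2, ℂ)} (hc : ∀ l, c l ∈ harmonicSpace l) :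
    ‖toL2 (∑ l ∈ s, c l)‖ ^ 2 = ∑ l ∈ s, ‖toL2 (c l)‖ ^ 2 := by
  have : (‖toL2 (∑ l ∈ s, c l)‖ ^ 2 : ℂ) = ∑ l ∈ s, (‖toL2 (c l)‖ ^ 2 : ℂ) := by
    have e : ∀ v : Lp ℂ 2 surfaceMeasure, (‖v‖ ^ 2 : ℂ) = inner ℂ v v :=
      fun v => (inner_self_eq_norm_sq_to_K v).symm
    simp only [e, map_sum, sum_inner, inner_sum]
    refine Finset.sum_congr rfl fun l hl => ?_
    exact Finset.sum_eq_single_of_mem l hl fun k _ hk => inner_harmonicSpace_of_ne hk (hc _) (hc _)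
  exact_mod_cast this

/-! ### The cut-off Legendre polynomial and its multipliers -/

theorem mem_cap_northPole {δ : ℝ} {x : S2} : x ∈ cap δ northPole ↔ δ ≤ height x := by
  rw [height, real_inner_comm]
  rfl

theorem measurableSet_cap (δ : ℝ) : MeasurableSet (cap δ northPole) := by
  have : cap δ northPole = height ⁻¹' Set.Ici δ := by
    ext x
    exact mem_cap_northPole
  rw [this]
  exact continuous_height.measurable measurableSet_Ici

theorem integral_cap_eval {δ : ℝ} (hδ : -1 ≤ δ) (hδ1 : δ ≤ 1) (p : ℝ[X]) :
    ∫ x, (cap δ northPole).indicator (fun x => p.eval (height x)) x ∂surfaceMeasure =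
      2 * Real.pi * ∫ t in δ..1, p.eval t := by
  have e : (cap δ northPole).indicator (fun x => p.eval (height x)) =
      fun x => (Set.Ici δ).indicator (fun t => p.eval t) (height x) := by
    ext x
    by_cases h : δ ≤ height x
    · rw [Set.indicator_of_mem (mem_cap_northPole.2 h), Set.indicator_of_mem (Set.mem_Ici.2 h)]
    · rw [Set.indicator_of_notMem (mt mem_cap_northPole.1 h), Set.indicator_of_notMem (mt Set.mem_Ici.1 h)]
  rw [e, ← integral_map (φ := height) (f := (Set.Ici δ).indicator fun t => p.eval t)
    continuous_height.aemeasurable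
    (p.continuous.measurable.indicator measurableSet_Ici).aestronglyMeasurable,
    map_height_surfaceMeasure, integral_smul_measure, ENNReal.toReal_ofReal (by positivity),
    smul_eq_mul, setIntegral_indicator measurableSet_Ici, intervalIntegral.integral_of_le hδ1,
    ← integral_Icc_eq_integral_Ioc]
  congr 3
  ext t
  simp only [Set.mem_inter_iff, Set.mem_Icc, Set.mem_Ici]
  constructor
  · rintro ⟨⟨-, h1⟩, h2⟩; exact ⟨h2, h1⟩
  · rintro ⟨h1, h2⟩; exact ⟨⟨hδ.trans h1, h2⟩, h1⟩

theorem memLp_gDelta (L : ℕ) (δ : ℝ) : MemLp (gDelta L δ) 2 surfaceMeasure := by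
  have h := (memLp_continuousMap (aeval coordZ (legendre L))).indicator (measurableSet_cap δ)
  convert h using 1
  unfold gDelta
  congr 1
  ext x
  rw [aeval_coordZ_apply]

theorem gDelta_mem_zonalL2 (L : ℕ) (δ : ℝ) : gDelta L δ ∈ zonalL2 δ := by
  refine ⟨memLp_gDelta L δ, fun x y hxy => ?_, Filter.Eventually.of_forall fun x hx =>
    Set.indicator_of_notMem hx _⟩
  simp only [gDelta, Set.indicator, mem_cap_northPole, hxy]

theorem multiplier_gDelta {δ : ℝ} (hδ : -1 ≤ δ) (hδ1 : δ ≤ 1) (L l : ℕ) :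
    multiplier (gDelta L δ) l =
      ((2 * Real.pi * ∫ t in δ..1, (legendre l * legendre L).eval t : ℝ) : ℂ) := by
  rw [← integral_cap_eval hδ hδ1, ← integral_complex_ofReal, multiplier]
  congr 1
  ext x
  by_cases h : x ∈ cap δ northPole
  · simp only [gDelta, Set.indicator_of_mem h, eval_mul, Complex.ofReal_mul]
  · simp [gDelta, Set.indicator_of_notMem h]

/-- The squared norm of `gDelta L δ`. -/
noncomputable def capEnergy (L : ℕ) (δ : ℝ) : ℝ :=
  2 * Real.pi * ∫ t in δ..1, (legendre L).eval t ^ 2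

theorem norm_gDelta_sq {δ : ℝ} (hδ : -1 ≤ δ) (hδ1 : δ ≤ 1) (L : ℕ) :
    ‖(memLp_gDelta L δ).toLp‖ ^ 2 = capEnergy L δ := by
  have h : ((‖(memLp_gDelta L δ).toLp‖ : ℂ)) ^ 2 = (capEnergy L δ : ℂ) := by
    refine (inner_self_eq_norm_sq_to_K (𝕜 := ℂ) ((memLp_gDelta L δ).toLp (gDelta L δ))).symm.trans ?_
    have h2 := integral_cap_eval hδ hδ1 (legendre L ^ 2)
    simp only [eval_pow] at h2
    rw [inner_toLp_eq_integral, capEnergy, ← h2, ← integral_complex_ofReal]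
    congr 1
    ext x
    by_cases h : x ∈ cap δ northPole
    · simp only [gDelta, Set.indicator_of_mem h, Complex.conj_ofReal]
      push_cast
      ring
    · simp [gDelta, Set.indicator_of_notMem h]
  exact_mod_cast h

theorem capEnergy_pos {L : ℕ} {δ : ℝ} (hδ : largestZero L ≤ δ) (hδ1 : δ < 1) :
    0 < capEnergy L δ := by
  refine mul_pos (by positivity) (intervalIntegral.intervalIntegral_pos_of_pos_on
    (((legendre L).continuous.pow 2).intervalIntegrable _ _) (fun t ht => ?_) hδ1)
  have := legendre_pos_of_largestZero_lt (hδ.trans_lt ht.1) ht.2.le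
  positivity

theorem capEnergy_le_norm_multiplier {L l : ℕ} (hl : l ≤ L) {δ : ℝ} (hδ : largestZero L ≤ δ)
    (hδ1 : δ < 1) : capEnergy L δ ≤ ‖multiplier (gDelta L δ) l‖ := by
  have h0 : -1 ≤ largestZero L := by linarith [largestZero_nonneg L]
  rw [multiplier_gDelta (h0.trans hδ) hδ1.le, Complex.norm_real]
  refine le_trans ?_ (le_abs_self _)
  refine mul_le_mul_of_nonneg_left (intervalIntegral.integral_mono_on_of_le_Ioo hδ1.le
    (((legendre L).continuous.pow 2).intervalIntegrable _ _)
    ((legendre l * legendre L).continuous.intervalIntegrable _ _) fun t ht => ?_) (by positivity)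
  have hpos : ∀ t, largestZero L < t → t ≤ 1 → 0 < (legendre L).eval t :=
    fun t h1 h2 => legendre_pos_of_largestZero_lt h1 h2
  have h1 := hδ.trans_lt ht.1
  rw [sq, eval_mul]
  exact mul_le_mul_of_nonneg_right (legendre_le_of_le h0 hpos hl h1 ht.2.le) (hpos t h1 ht.2.le).le

theorem eLpNorm_sq_eq_ofReal {f : S2 → ℂ} (hf : MemLp f 2 surfaceMeasure) :
    eLpNorm f 2 surfaceMeasure ^ 2 = ENNReal.ofReal (‖hf.toLp f‖ ^ 2) := by
  rw [Lp.norm_toLp, ENNReal.ofReal_pow ENNReal.toReal_nonneg, ENNReal.ofReal_toReal hf.eLpNorm_ne_top]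

theorem eLpNorm_continuousMap_sq (f : C(S2, ℂ)) :
    eLpNorm f 2 surfaceMeasure ^ 2 = ENNReal.ofReal (‖toL2 f‖ ^ 2) := by
  rw [eLpNorm_sq_eq_ofReal (memLp_continuousMap f), toL2_eq_toLp]

theorem toLp_eq_zero_iff {f : S2 → ℂ} (hf : MemLp f 2 surfaceMeasure) :
    hf.toLp f = 0 ↔ f ∈ nullFunctions := by
  rw [Lp.eq_zero_iff_ae_eq_zero]
  exact ⟨fun h => hf.coeFn_toLp.symm.trans h, fun h => hf.coeFn_toLp.trans h⟩

theorem norm_toLp_pos {f : S2 → ℂ} (hf : MemLp f 2 surfaceMeasure) (h : f ∉ nullFunctions) :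
    0 < ‖hf.toLp f‖ := by
  rw [norm_pos_iff]
  exact mt (toLp_eq_zero_iff hf).1 h

/-! ### The two bounds for the extremal problem -/

theorem supQuotient_gDelta_le {L : ℕ} {δ : ℝ} (hδ : largestZero L ≤ δ) (hδ1 : δ < 1) :
    supQuotient L (gDelta L δ) ≤ ENNReal.ofReal (capEnergy L δ)⁻¹ := by
  have h0 : -1 ≤ δ := by linarith [largestZero_nonneg L]
  have hA := capEnergy_pos hδ hδ1
  refine iSup₂_le fun h ⟨hh, _⟩ => ?_
  obtain ⟨p, hp, hhp⟩ := exists_polySpace_ae_eq hh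
  obtain ⟨c, hc, rfl⟩ := exists_sum_harmonic hp
  rw [conv_sum_harmonic hc hhp (memLp_gDelta L δ) (gDelta_mem_zonalL2 L δ).2.1,
    eLpNorm_congr_ae hhp, eLpNorm_continuousMap_sq, eLpNorm_continuousMap_sq,
    eLpNorm_sq_eq_ofReal (memLp_gDelta L δ), norm_gDelta_sq h0 hδ1.le]
  refine ENNReal.div_le_of_le_mul ?_
  rw [← ENNReal.ofReal_mul (by positivity), ← ENNReal.ofReal_mul (by positivity)]
  refine ENNReal.ofReal_le_ofReal ?_
  rw [norm_toL2_sum_sq hc, norm_toL2_sum_sq fun l => Submodule.smul_mem _ _ (hc l),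
    le_inv_mul_iff₀ hA, Finset.sum_mul, Finset.mul_sum]
  -- Degree by degree, it suffices that the squared multiplier is at least `capEnergy L δ ^ 2`.
  refine Finset.sum_le_sum fun l hl => ?_
  have hle := capEnergy_le_norm_multiplier (Finset.mem_range_succ_iff.1 hl) hδ hδ1
  rw [map_smul, norm_smul, mul_pow]
  have := pow_le_pow_left₀ hA.le hle 2
  nlinarith [sq_nonneg ‖toL2 (c l)‖]

/-- Cauchy–Schwarz against `gDelta L δ`, which may replace `P_L(z)` because `g` vanishes off the
cap. -/
theorem norm_multiplier_sq_le {L : ℕ} {δ : ℝ} (hδ : -1 ≤ δ) (hδ1 : δ ≤ 1) {g : S2 → ℂ}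
    (hg : g ∈ zonalL2 δ) :
    ‖multiplier g L‖ ^ 2 ≤ capEnergy L δ * ‖hg.1.toLp g‖ ^ 2 := by
  have e : multiplier g L = inner ℂ ((memLp_gDelta L δ).toLp) (hg.1.toLp g) := by
    rw [inner_toLp_eq_integral]
    refine integral_congr_ae ?_
    filter_upwards [hg.2.2] with x hx
    by_cases h : x ∈ cap δ northPole
    · simp only [gDelta, Set.indicator_of_mem h, Complex.conj_ofReal]
      ring
    · simp [hx h]
  rw [e, ← norm_gDelta_sq hδ hδ1, ← mul_pow]
  exact pow_le_pow_left₀ (norm_nonneg _) (norm_inner_le_norm _ _) 2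

theorem le_supQuotient {L : ℕ} {δ : ℝ} (hδ : largestZero L ≤ δ) (hδ1 : δ < 1) {g : S2 → ℂ}
    (hg : g ∈ zonalL2 δ \ nullFunctions) :
    ENNReal.ofReal (capEnergy L δ)⁻¹ ≤ supQuotient L g := by
  have h0 : -1 ≤ δ := by linarith [largestZero_nonneg L]
  have hA := capEnergy_pos hδ hδ1
  set p : C(S2, ℂ) := aeval coordZ (legendre L)
  have hp : toL2 p ≠ 0 := fun h => by
    have h' : p = 0 := ContinuousMap.toLp_injective (p := 2) (𝕜 := ℂ) surfaceMeasure
      (h.trans (map_zero toL2).symm)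
    have := congrArg (fun f : C(S2, ℂ) => f northPole) h'
    simp [p, aeval_coordZ_apply, northPole_height, legendre_eval_one] at this
  have hpn : ⇑p ∉ nullFunctions := fun h => hp <| by
    rw [toL2_eq_toLp]
    exact (toLp_eq_zero_iff _).2 h
  refine le_trans ?_ (le_iSup₂ (⇑p) ⟨aeval_legendre_mem_bandLimited L, hpn⟩)
  have hconv : conv p g = ⇑(multiplier g L • p) := by
    ext x
    exact conv_harmonic (aeval_legendre_mem_harmonicSpace L) hg.1.1 hg.1.2.1 x
  have hpos := norm_toLp_pos hg.1.1 hg.2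
  have hpp := norm_pos_iff.2 hp
  rw [hconv, eLpNorm_continuousMap_sq, eLpNorm_continuousMap_sq, eLpNorm_sq_eq_ofReal hg.1.1,
    -- The multiplier may vanish; the quotient is then `∞`, and the nonzero numerator justifies
    -- clearing the denominator.
    ← ENNReal.ofReal_mul (by positivity), ENNReal.le_div_iff_mul_le
      (Or.inr (ENNReal.ofReal_pos.2 (by positivity)).ne') (Or.inl ENNReal.ofReal_ne_top),
    ← ENNReal.ofReal_mul (by positivity)]
  refine ENNReal.ofReal_le_ofReal ?_
  rw [inv_mul_le_iff₀ hA, map_smul, norm_smul, mul_pow]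
  have := norm_multiplier_sq_le (L := L) h0 hδ1.le hg.1
  nlinarith [sq_nonneg ‖toL2 p‖]

end SphereSieve

theorem mainTheorem2 (L : ℕ) (hL : 1 ≤ L) (δ : ℝ) (hδ : largestZero L ≤ δ) (hδ1 : δ < 1) :
    gDelta L δ ∈ zonalL2 δ \ nullFunctions ∧
    IsMinOn (supQuotient L) (zonalL2 δ \ nullFunctions) (gDelta L δ) ∧
    supQuotient L (gDelta L δ) = C2 L δ ∧
    C2 L δ = ENNReal.ofReal (2 * Real.pi * ∫ t in δ..1, (legendre L).eval t ^ 2)⁻¹ := by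
  have hnull : gDelta L δ ∉ nullFunctions := fun h => by
    have h1 := norm_gDelta_sq (by linarith [largestZero_nonneg L]) hδ1.le L
    have h2 : (memLp_gDelta L δ).toLp = 0 := (toLp_eq_zero_iff _).2 h
    rw [h2, norm_zero] at h1
    have := capEnergy_pos hδ hδ1
    simp [← h1] at this
  have hmem : gDelta L δ ∈ zonalL2 δ \ nullFunctions := ⟨gDelta_mem_zonalL2 L δ, hnull⟩
  have hval : supQuotient L (gDelta L δ) = ENNReal.ofReal (capEnergy L δ)⁻¹ :=
    le_antisymm (supQuotient_gDelta_le hδ hδ1) (le_supQuotient hδ hδ1 hmem)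
  have hC : C2 L δ = ENNReal.ofReal (capEnergy L δ)⁻¹ :=
    le_antisymm ((iInf₂_le _ hmem).trans hval.le) (le_iInf₂ fun g hg => le_supQuotient hδ hδ1 hg)
  exact ⟨hmem, fun g hg => hval.le.trans (le_supQuotient hδ hδ1 hg), hval.trans hC.symm, hC⟩
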